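/- Let $X$ be a second countable locally compact Hausdorff space with Borel $\sigma$-algebra, let $\mathscr P(X)$ be the space of Borel probability measures on $X$ with the narrow topology (duality with bounded continuous functions) and its Borel $\sigma$-algebra, and let $\mathscr P(\mathscr P(X))$ carry the corresponding narrow topology. Let $\sigma\in\mathscr P(X)$. For $\beta>0$ let $\mathcal D_{\beta\sigma}\in\mathscr P(\mathscr P(X))$ be the Dirichlet--Ferguson measure with intensity $\beta\sigma$: the (existing and unique) probability measure on $\mathscr P(X)$ such that, for every $k\ge 1$ and every measurable partition $(X_1,\dots,X_k)$ of $X$ with $\sigma X_i>0$ for all $i$, the law of $(\eta X_1,\dots,\eta X_k)$ under $\mathcal D_{\beta\sigma}(d\eta)$ is the Dirichlet distribution with parameter $(\beta\sigma X_1,\dots,\beta\sigma X_k)$, and such that $\eta A=0$ for $\mathcal D_{\beta\sigma}$-a.e. $\eta$ whenever $A$ is Borel with $\sigma A=0$ (this last requirement follows from the first unless $\sigma$ is a Dirac mass). Here the Dirichlet distribution with parameter $\alpha\in(0,\infty)^k$ is the probability measure on the simplex $\{y\in\mathbb R^k: y\ge 0,\ \sum_i y_i=1\}$ with density $\frac{\Gamma(\sum_i\alpha_i)}{\prod_i\Gamma(\alpha_i)}\prod_i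 y_i^{\alpha_i-1}$ in the coordinates $(y_1,\dots,y_{k-1})$ (the Dirac mass at $1$ if $k=1$). For $\eta\in\mathscr P(X)$ write $\eta f=\int_X f\,d\eta$, and let $\widehat{\mathcal D_{\beta\sigma}}(tf^*)=\int_{\mathscr P(X)}e^{\mathrm i t\,\eta f}\,d\mathcal D_{\beta\sigma}(\eta)$. Then, for every continuous compactly supported $f\colon X\to\mathbb R$ and every $t\in\mathbb C$, the following limits exist and $$\lim_{\beta\downarrow 0}\widehat{\mathcal D_{\beta\sigma}}(tf^*)=\int_X e^{\mathrm i t f}\,d\sigma,\qquad \lim_{\beta\to\infty}\widehat{\mathcal D_{\beta\sigma}}(tf^*)=e^{\mathrm i t\,\sigma f}.$$ Correspondingly, in the narrow topology of $\mathscr P(\mathscr P(X))$, $$\lim_{\beta\downarrow 0}\mathcal D_{\beta\sigma}=\delta_\sharp\sigma,\qquad \lim_{\beta\to\infty}\mathcal D_{\beta\sigma}=\delta_\sigma,$$ where $\delta\colon X\to\mathscr P(X)$, $x\mapsto\delta_x$, so that $\delta_\sharp\sigma$ is the law of $\delta_x$ with $x\sim\sigma$, and $\delta_\sigma$ is the Dirac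 mass at $\sigma$. -/

import Mathlib

open MeasureTheory Filter Topology Set

/-! ### The narrow topology and the sigma-algebra on the space of probability measures -/

/-- On a separable (pseudo)metrizable space `X`, every narrowly open set of probability measures is
measurable for the sigma-algebra generated by the evaluations `η ↦ η A`. Hence Mathlib's
sigma-algebra on `ProbabilityMeasure X` is the Borel sigma-algebra of the narrow topology. -/
theorem opensMeasurableSpace_probabilityMeasure {X : Type*} [TopologicalSpace X]
    [TopologicalSpace.PseudoMetrizableSpace X] [SecondCountableTopology X]
    [MeasurableSpace X] [BorelSpace X] :
    OpensMeasurableSpace (ProbabilityMeasure X) := by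
  have hmn : ∀ {Y : Type _} (t : TopologicalSpace Y) (s : Set Y) (y : Y), IsOpen[t] s → y ∈ s →
      s ∈ @nhds Y t y := fun t s y hs hy => hs.mem_nhds hy
  obtain ⟨B, hBc, -, hB⟩ := TopologicalSpace.exists_countable_basis X
  let V : Set (Set X) := (fun F : Set (Set X) => ⋃₀ F) '' {F | F ⊆ B ∧ F.Finite}
  have hFc : {F : Set (Set X) | F ⊆ B ∧ F.Finite}.Countable := by
    refine (Set.countable_ofPred_finite_subset hBc).mono fun F hF => ?_
    exact ⟨hF.2, hF.1⟩
  have hVc : V.Countable := hFc.image _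
  have hVo : ∀ U ∈ V, IsOpen U := by
    rintro _ ⟨F, hF, rfl⟩
    exact isOpen_sUnion fun s hs => hB.isOpen (hF.1 hs)
  obtain ⟨Q, hQc, hQd⟩ := TopologicalSpace.exists_countable_dense ENNReal
  let S : Set (Set (ProbabilityMeasure X)) :=
    (fun p : Set X × ENNReal => {η : ProbabilityMeasure X | p.2 < (η : Measure X) p.1}) '' (V ×ˢ Q)
  have hSc : S.Countable := (hVc.prod hQc).image _
  have h2 : @SecondCountableTopology _ (TopologicalSpace.generateFrom S) :=
    @SecondCountableTopology.mk _ (TopologicalSpace.generateFrom S) ⟨S, hSc, rfl⟩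
  have hle : TopologicalSpace.generateFrom S ≤
      (ProbabilityMeasure.instTopologicalSpace : TopologicalSpace (ProbabilityMeasure X)) := by
    refine le_of_nhds_le_nhds fun μ => ?_
    have hcg : (@nhds _ (TopologicalSpace.generateFrom S) μ).IsCountablyGenerated :=
      @FirstCountableTopology.nhds_generated_countable _ (TopologicalSpace.generateFrom S)
        (@TopologicalSpace.SecondCountableTopology.to_firstCountableTopology _ (TopologicalSpace.generateFrom S) h2) μ
    have key : Tendsto (fun η : ProbabilityMeasure X => η)
        (@nhds _ (TopologicalSpace.generateFrom S) μ) (𝓝 μ) := by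
      refine tendsto_of_forall_isOpen_le_liminf' fun G hG => ?_
      refine le_of_forall_lt fun c hcG => ?_
      obtain ⟨q, hq, hcq, hqG⟩ : ∃ q ∈ Q, c < q ∧ q < (μ : Measure X) G := by
        obtain ⟨q, hq⟩ := hQd.exists_between hcG
        exact ⟨q, hq.1, hq.2.1, hq.2.2⟩
      obtain ⟨U, hU, hUG, hqU⟩ : ∃ U ∈ V, U ⊆ G ∧ q < (μ : Measure X) U := by
        obtain ⟨C, hCB, hCG⟩ := hB.open_eq_sUnion hG
        have hCc : Countable C := (hBc.mono hCB).to_subtype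
        have hU : G = ⋃ F : Finset C, ⋃ s ∈ F, (s : Set X) := by
          rw [hCG, sUnion_eq_iUnion, iUnion_eq_iUnion_finset]
        have hdir : Directed (· ⊆ ·) (fun F : Finset C => ⋃ s ∈ F, (s : Set X)) :=
          Monotone.directed_le fun F F' h => biUnion_subset_biUnion_left h
        rw [hU, hdir.measure_iUnion, lt_iSup_iff] at hqG
        obtain ⟨F, hF⟩ := hqG
        refine ⟨_, ⟨(fun s : C => (s : Set X)) '' (F : Set C), ⟨?_, F.finite_toSet.image _⟩, rfl⟩,
          ?_, ?_⟩
        · rintro _ ⟨s, -, rfl⟩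
          exact hCB s.2
        · rw [hCG]
          refine sUnion_subset ?_
          rintro _ ⟨s, -, rfl⟩
          exact subset_sUnion_of_mem s.2
        · simpa [sUnion_image] using hF
      have hmem : {η : ProbabilityMeasure X | q < (η : Measure X) U} ∈ @nhds _ (TopologicalSpace.generateFrom S) μ :=
        hmn (TopologicalSpace.generateFrom S) _ _
          (TopologicalSpace.isOpen_generateFrom_of_mem ⟨(U, q), ⟨hU, hq⟩, rfl⟩) hqU
      refine lt_of_lt_of_le hcq (le_liminf_of_le (by isBoundedDefault) ?_)
      filter_upwards [hmem] with η hη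
      exact (le_of_lt hη).trans (measure_mono hUG)
    exact key
  refine ⟨?_⟩
  refine (borel_anti hle).trans ?_
  rw [@borel_eq_generateFrom_of_subbasis _ S (TopologicalSpace.generateFrom S) h2 rfl]
  refine MeasurableSpace.generateFrom_le ?_
  rintro _ ⟨⟨U, q⟩, ⟨hU, -⟩, rfl⟩
  exact measurableSet_lt measurable_const
    ((Measure.measurable_coe (hVo U hU).measurableSet).comp measurable_subtype_coe)

instance instOpensMeasurableSpaceProbabilityMeasure {X : Type*} [TopologicalSpace X]
    [TopologicalSpace.PseudoMetrizableSpace X] [SecondCountableTopology X]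
    [MeasurableSpace X] [BorelSpace X] :
    OpensMeasurableSpace (ProbabilityMeasure X) :=
  opensMeasurableSpace_probabilityMeasure

theorem measurable_diracProba_embedding {X : Type*} [MeasurableSpace X] :
    Measurable (fun x : X => diracProba x) :=
  Measurable.subtype_mk Measure.measurable_dirac

noncomputable section

/-- The law `δ_♯ σ` of the random Dirac mass `δ_x`, where `x` has law `σ`. -/
def diracPushforward {X : Type*} [MeasurableSpace X] (σ : ProbabilityMeasure X) :
    ProbabilityMeasure (ProbabilityMeasure X) :=
  σ.map (f := fun x : X => diracProba x) measurable_diracProba_embedding.aemeasurable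

/-! ### The Dirichlet distribution -/

/-- The multivariate Euler Beta function `∏ Γ(α_i) / Γ(∑ α_i)`. -/
def multiBeta {n : ℕ} (α : Fin (n + 1) → ℝ) : ℝ :=
  (∏ i, Real.Gamma (α i)) / Real.Gamma (∑ i, α i)

/-- The point `(z_0, …, z_{n-1}, 1 - ∑ z_i)` of the hyperplane `∑ y_i = 1` in `ℝ^(n+1)`. -/
def simplexPoint {n : ℕ} (z : Fin n → ℝ) : Fin (n + 1) → ℝ :=
  Fin.snoc (α := fun _ => ℝ) z (1 - ∑ i, z i)

/-- The density of the Dirichlet distribution in the coordinates `z = (y_0, …, y_{n-1})`: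
it is `∏ y_i ^ (α_i - 1) / B(α)` on the interior of the corner simplex, where
`y = (z, 1 - ∑ z_i)`, and zero elsewhere. -/
def dirichletPDF {n : ℕ} (α : Fin (n + 1) → ℝ) (z : Fin n → ℝ) : ℝ :=
  open Classical in
  if (∀ i, 0 < simplexPoint z i) then
    (∏ i, simplexPoint z i ^ (α i - 1)) / multiBeta α
  else 0

/-- The Dirichlet distribution with parameter `α` in `(0, ∞)^(n+1)`, as a measure on `ℝ^(n+1)`
concentrated on the standard simplex. For `n = 0` it is the Dirac mass at the point `1`. -/
def dirichletMeasure {n : ℕ} (α : Fin (n + 1) → ℝ) : Measure (Fin (n + 1) → ℝ) :=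
  ((volume : Measure (Fin n → ℝ)).withDensity
    (fun z => ENNReal.ofReal (dirichletPDF α z))).map simplexPoint

/-! ### The Dirichlet--Ferguson measure -/

/-- Finite ordered measurable partitions of `X` all of whose cells have positive `σ`-mass. -/
structure IsNontrivialPartition {X : Type*} [MeasurableSpace X] (σ : Measure X) {k : ℕ}
    (A : Fin k → Set X) : Prop where
  measurableSet : ∀ i, MeasurableSet (A i)
  pos : ∀ i, 0 < σ (A i)
  disjoint : ∀ i j, i ≠ j → Disjoint (A i) (A j)
  iUnion_eq : ⋃ i, A i = univ

/-- `D` is a Dirichlet--Ferguson measure with intensity `β σ`: for every nontrivial partition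
`(A_0, …, A_n)`, the law under `D` of the vector `(η A_0, …, η A_n)` is the Dirichlet distribution
with parameter `(β σ A_0, …, β σ A_n)`.

The second clause is the usual convention for cells with `σ A = 0`: a Dirichlet coordinate with
parameter zero vanishes almost surely. It follows from the first clause unless `σ` only takes
the values zero and one; in that case the first clause alone says nothing. -/
structure IsDirichletFerguson {X : Type*} [MeasurableSpace X] (β : ℝ) (σ : ProbabilityMeasure X)
    (D : ProbabilityMeasure (ProbabilityMeasure X)) : Prop where
  map_eval : ∀ (n : ℕ) (A : Fin (n + 1) → Set X), IsNontrivialPartition (σ : Measure X) A →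
    (D : Measure (ProbabilityMeasure X)).map
        (fun (η : ProbabilityMeasure X) (i : Fin (n + 1)) => (η : Measure X).real (A i)) =
      dirichletMeasure (fun i => β * (σ : Measure X).real (A i))
  null : ∀ A : Set X, MeasurableSet A → (σ : Measure X) A = 0 →
    ∀ᵐ (η : ProbabilityMeasure X) ∂(D : Measure (ProbabilityMeasure X)), (η : Measure X) A = 0

open Classical in
/-- The Dirichlet--Ferguson measure with intensity `β σ`, i.e. the random probability characterized
by `IsDirichletFerguson` (with an irrelevant value in case there were none). -/
def dirichletFerguson {X : Type*} [MeasurableSpace X] (β : ℝ) (σ : ProbabilityMeasure X) :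
    ProbabilityMeasure (ProbabilityMeasure X) :=
  if h : ∃ D, IsDirichletFerguson β σ D then h.choose else diracProba σ

/-- The characteristic functional of a random probability `D`, at the linear functional
`η ↦ t * ∫ f dη`, for real `f` and complex `t`. -/
def randomCharFun {X : Type*} [MeasurableSpace X]
    (D : ProbabilityMeasure (ProbabilityMeasure X)) (t : ℂ) (f : X → ℝ) : ℂ :=
  ∫ η : ProbabilityMeasure X, Complex.exp (Complex.I * t * ((∫ x, f x ∂(η : Measure X) : ℝ) : ℂ))
    ∂(D : Measure (ProbabilityMeasure X))

end

/-! The Dirichlet–Ferguson measure is realized by stick breaking: η = ∑ Wₙ δ_{xₙ} with xₙ i.i.d. of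
law σ, the fractions Vₙ kept at each break being independent Beta(β,1) variables, coupled over all β
as Vₙ = Uₙ^(1/β). Peeling off the first break gives η = (1 - V) δ_x + V η', with η' an independent
copy of η.

Identification: for bounded measurable f this self-similarity makes the moments of ηf, normalized by
Γ(β+m)/(Γ(β) m!), satisfy Newton's recursion with power sums β ∫ f^j dσ
(`isNewtonSeq_stickFerguson`). The moments of ∑ sᵢ yᵢ under a Dirichlet law satisfy it with power
sums ∑ αᵢ sᵢ^j, since their generating function is ∏ (1 - sᵢ X)^(-αᵢ)
(`isNewtonSeq_dirichletMeasure`). For f = ∑ sᵢ 1_{Aᵢ} the power sums coincide, and moments determine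
laws on a cube, so the stick-breaking law has the defining marginals. These marginals and the
null-set condition determine it (`IsDirichletFerguson.unique`).

Limits: as β ↓ 0, U₀^(1/β) → 0 almost surely, so η → δ_{x₀} and dominated convergence applies. As β
→ ∞, the variance of ηf is that of f under σ divided by β + 1, so Chebyshev's inequality
concentrates the law at σ. The limits of the characteristic functionals follow because η ↦ exp(i t
ηf) is bounded and continuous. -/

/-! ### The Dirichlet integral -/

open Classical in
/-- The unnormalized Dirichlet density. -/
noncomputable def dirichletWeight {n : ℕ} (α : Fin (n + 1) → ℝ) (z : Fin n → ℝ) : ℝ :=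
  if (∀ i, 0 < simplexPoint z i) then ∏ i, simplexPoint z i ^ (α i - 1) else 0

theorem dirichletPDF_eq_weight_div {n : ℕ} (α : Fin (n + 1) → ℝ) (z : Fin n → ℝ) :
    dirichletPDF α z = dirichletWeight α z / multiBeta α := by
  unfold dirichletPDF dirichletWeight
  split_ifs <;> simp

theorem dirichletWeight_nonneg {n : ℕ} (α : Fin (n + 1) → ℝ) (z : Fin n → ℝ) :
    0 ≤ dirichletWeight α z := by
  unfold dirichletWeight
  split_ifs with h
  · exact Finset.prod_nonneg fun i _ => Real.rpow_nonneg (h i).le _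
  · exact le_rfl

theorem measurable_simplexPoint {n : ℕ} :
    Measurable (simplexPoint : (Fin n → ℝ) → Fin (n + 1) → ℝ) := by
  refine measurable_pi_iff.2 fun i => ?_
  refine Fin.lastCases ?_ (fun j => ?_) i
  · simp only [simplexPoint, Fin.snoc_last]
    fun_prop
  · simp only [simplexPoint, Fin.snoc_castSucc]
    fun_prop

theorem sum_simplexPoint {n : ℕ} (z : Fin n → ℝ) : ∑ i, simplexPoint z i = 1 := by
  simp [simplexPoint, Fin.sum_univ_castSucc]

theorem measurable_dirichletWeight {n : ℕ} (α : Fin (n + 1) → ℝ) :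
    Measurable (dirichletWeight α) := by
  have hm : ∀ i, Measurable fun z : Fin n → ℝ => simplexPoint z i := fun i =>
    (measurable_pi_apply i).comp measurable_simplexPoint
  refine Measurable.ite ?_ ?_ measurable_const
  · have : {z : Fin n → ℝ | ∀ i, 0 < simplexPoint z i} = ⋂ i, {z | 0 < simplexPoint z i} := by
      ext; simp
    rw [this]
    exact MeasurableSet.iInter fun i => measurableSet_lt measurable_const (hm i)
  · exact Finset.measurable_prod _ fun i _ => (hm i).pow_const _

theorem multiBeta_pos {n : ℕ} {α : Fin (n + 1) → ℝ} (hα : ∀ i, 0 < α i) : 0 < multiBeta α :=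
  div_pos (Finset.prod_pos fun i _ => Real.Gamma_pos_of_pos (hα i))
    (Real.Gamma_pos_of_pos (Finset.sum_pos (fun i _ => hα i) Finset.univ_nonempty))

theorem simplexPoint_cons_smul {n : ℕ} (s : ℝ) (w : Fin n → ℝ) :
    simplexPoint (Fin.cons s ((1 - s) • w) : Fin (n + 1) → ℝ) =
      (Fin.cons s ((1 - s) • simplexPoint w) : Fin (n + 2) → ℝ) := by
  rw [simplexPoint, ← Fin.cons_snoc_eq_snoc_cons]
  congr 1
  ext i
  refine Fin.lastCases ?_ (fun j => ?_) i
  · simp [simplexPoint, Fin.sum_univ_succ, ← Finset.mul_sum]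
    ring
  · simp [simplexPoint]

/-- The slice of the simplex at first coordinate s is a copy of the lower-dimensional simplex scaled
by 1 - s, and each of its n + 1 factors is homogeneous. This drives the induction for the Dirichlet
integral. -/
theorem dirichletWeight_cons_smul {n : ℕ} (α : Fin (n + 2) → ℝ) {s : ℝ} (h0 : 0 < s) (h1 : s < 1)
    (w : Fin n → ℝ) :
    dirichletWeight α (Fin.cons s ((1 - s) • w) : Fin (n + 1) → ℝ) =
      s ^ (α 0 - 1) * (1 - s) ^ (∑ i : Fin (n + 1), (α i.succ - 1)) *
        dirichletWeight (fun i => α i.succ) w := by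
  have h1' : 0 < 1 - s := sub_pos.2 h1
  have hiff : (∀ i, 0 < simplexPoint (Fin.cons s ((1 - s) • w) : Fin (n + 1) → ℝ) i) ↔
      ∀ i, 0 < simplexPoint w i := by
    rw [simplexPoint_cons_smul, Fin.forall_fin_succ]
    simp [h0, h1', mul_pos_iff_of_pos_left]
  unfold dirichletWeight
  by_cases h : ∀ i, 0 < simplexPoint w i
  · rw [if_pos h, if_pos (hiff.2 h), simplexPoint_cons_smul, Fin.prod_univ_succ]
    simp only [Fin.cons_zero, Fin.cons_succ, Pi.smul_apply, smul_eq_mul]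
    rw [mul_assoc, Real.rpow_sum_of_pos h1', ← Finset.prod_mul_distrib]
    congr 1
    exact Finset.prod_congr rfl fun i _ => Real.mul_rpow h1'.le (h i).le
  · rw [if_neg h, if_neg (fun h' => h (hiff.1 h')), mul_zero]

theorem dirichletWeight_cons_eq_zero {n : ℕ} (α : Fin (n + 2) → ℝ) {s : ℝ}
    (hs : ¬ (0 < s ∧ s < 1)) (w : Fin n → ℝ) :
    dirichletWeight α (Fin.cons s w : Fin (n + 1) → ℝ) = 0 := by
  refine if_neg fun h => hs ?_
  have h0 : simplexPoint (Fin.cons s w : Fin (n + 1) → ℝ) 0 = s := by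
    have : (0 : Fin (n + 2)) = Fin.castSucc 0 := rfl
    rw [this, simplexPoint, Fin.snoc_castSucc]
    rfl
  have hsum := sum_simplexPoint (Fin.cons s w : Fin (n + 1) → ℝ)
  rw [Fin.sum_univ_succ, h0] at hsum
  have hpos : 0 < ∑ i : Fin (n + 1), simplexPoint (Fin.cons s w : Fin (n + 1) → ℝ) i.succ :=
    Finset.sum_pos (fun i _ => h _) Finset.univ_nonempty
  exact ⟨h0 ▸ h 0, by linarith⟩

theorem lintegral_eq_mul_lintegral_comp_smul {n : ℕ} {r : ℝ} (hr : 0 < r)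
    {g : (Fin n → ℝ) → ENNReal} (hg : Measurable g) :
    ∫⁻ z, g z = ENNReal.ofReal (r ^ n) * ∫⁻ w, g (r • w) := by
  have h := Measure.map_addHaar_smul (volume : Measure (Fin n → ℝ)) hr.ne'
  rw [Module.finrank_fin_fun] at h
  have h2 : ∫⁻ w, g (r • w) = ENNReal.ofReal ((r ^ n)⁻¹) * ∫⁻ z, g z := by
    rw [← lintegral_map hg (measurable_const_smul r), h, lintegral_smul_measure,
      abs_of_pos (by positivity), smul_eq_mul]
  rw [h2, ← mul_assoc, ← ENNReal.ofReal_mul (by positivity), mul_inv_cancel₀ (by positivity)]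
  simp

theorem lintegral_beta {a b : ℝ} (ha : 0 < a) (hb : 0 < b) :
    ∫⁻ x : ℝ, ENNReal.ofReal (if 0 < x ∧ x < 1 then x ^ (a - 1) * (1 - x) ^ (b - 1) else 0) =
      ENNReal.ofReal (Real.Gamma a * Real.Gamma b / Real.Gamma (a + b)) := by
  have hB := ProbabilityTheory.beta_pos ha hb
  have h : ∀ x : ℝ,
      ENNReal.ofReal (if 0 < x ∧ x < 1 then x ^ (a - 1) * (1 - x) ^ (b - 1) else 0) =
        ENNReal.ofReal (ProbabilityTheory.beta a b) * ProbabilityTheory.betaPDF a b x := by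
    intro x
    rw [ProbabilityTheory.betaPDF_eq, ← ENNReal.ofReal_mul hB.le]
    congr 1
    split_ifs
    · field_simp
    · simp
  simp_rw [h]
  rw [lintegral_const_mul' _ _ ENNReal.ofReal_ne_top,
    ProbabilityTheory.lintegral_betaPDF_eq_one ha hb, mul_one]
  rfl

/-- The Dirichlet (Liouville) integral over the corner simplex. -/
theorem lintegral_dirichletWeight {n : ℕ} (α : Fin (n + 1) → ℝ) (hα : ∀ i, 0 < α i) :
    ∫⁻ z, ENNReal.ofReal (dirichletWeight α z) = ENNReal.ofReal (multiBeta α) := by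
  induction n with
  | zero =>
    have hw : ∀ z : Fin 0 → ℝ, dirichletWeight α z = 1 := by
      intro z
      have : ∀ i, simplexPoint z i = 1 := by
        intro i
        have := sum_simplexPoint z
        rw [Fin.eq_zero i]
        simpa using this
      simp [dirichletWeight, this]
    have hG : Real.Gamma (α 0) ≠ 0 := (Real.Gamma_pos_of_pos (hα 0)).ne'
    simp [hw, multiBeta, hG, volume_pi]
  | succ n ih =>
    let T : Fin (n + 1) → ℝ := fun i => α i.succ
    have hT : ∀ i, 0 < T i := fun i => hα _
    have hTs : 0 < ∑ i, T i := Finset.sum_pos (fun i _ => hT i) Finset.univ_nonempty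
    have hmeas : Measurable fun z => ENNReal.ofReal (dirichletWeight α z) :=
      (measurable_dirichletWeight α).ennreal_ofReal
    let e := MeasurableEquiv.piFinSuccAbove (fun _ : Fin (n + 1) => ℝ) 0
    have he : ∀ p : ℝ × (Fin n → ℝ), e.symm p = (Fin.cons p.1 p.2 : Fin (n + 1) → ℝ) := by
      intro p
      simp only [e, MeasurableEquiv.piFinSuccAbove]
      exact Fin.insertNth_zero (α := fun _ => ℝ) p.1 p.2
    have hpres := (volume_preserving_piFinSuccAbove (fun _ : Fin (n + 1) => ℝ) 0).symm e
    rw [← hpres.lintegral_comp hmeas, Measure.volume_eq_prod,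
      lintegral_prod (fun p => ENNReal.ofReal (dirichletWeight α (e.symm p)))
        (hmeas.comp e.symm.measurable).aemeasurable]
    have hin : ∀ s : ℝ, ∫⁻ w : Fin n → ℝ, ENNReal.ofReal (dirichletWeight α (e.symm (s, w))) =
        ENNReal.ofReal (multiBeta T) *
          ENNReal.ofReal (if 0 < s ∧ s < 1 then
            s ^ (α 0 - 1) * (1 - s) ^ ((∑ i, T i) - 1) else 0) := by
      intro s
      simp_rw [he]
      split_ifs with hs
      · have h1' : 0 < 1 - s := sub_pos.2 hs.2
        have hm : Measurable fun w : Fin n → ℝ =>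
            ENNReal.ofReal (dirichletWeight α (Fin.cons s w : Fin (n + 1) → ℝ)) := by
          have := (hmeas.comp e.symm.measurable).comp (measurable_prodMk_left (x := s))
          simpa only [Function.comp_def, he] using this
        rw [lintegral_eq_mul_lintegral_comp_smul h1' hm]
        simp_rw [dirichletWeight_cons_smul α hs.1 hs.2]
        have hc : 0 ≤ s ^ (α 0 - 1) * (1 - s) ^ (∑ i : Fin (n + 1), (α i.succ - 1)) :=
          mul_nonneg (Real.rpow_nonneg hs.1.le _) (Real.rpow_nonneg h1'.le _)
        simp_rw [ENNReal.ofReal_mul hc]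
        rw [lintegral_const_mul _ (measurable_dirichletWeight _).ennreal_ofReal, ih T hT,
          ← ENNReal.ofReal_mul hc, ← ENNReal.ofReal_mul (by positivity),
          ← ENNReal.ofReal_mul (multiBeta_pos hT).le]
        congr 1
        -- The Jacobian (1 - s)^n combines with the n + 1 exponents `T i - 1`, leaving a Beta
        -- integrand with second parameter `∑ T i`.
        have : (1 - s) ^ ((∑ i, T i) - 1) =
            (1 - s) ^ n * (1 - s) ^ (∑ i : Fin (n + 1), (α i.succ - 1)) := by
          rw [← Real.rpow_natCast, ← Real.rpow_add h1']
          congr 1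
          simp [T, Finset.sum_sub_distrib]
          ring
        rw [this]
        ring
      · simp_rw [dirichletWeight_cons_eq_zero α hs]
        simp
    simp_rw [hin]
    rw [lintegral_const_mul' _ _ ENNReal.ofReal_ne_top, lintegral_beta (hα 0) hTs,
      ← ENNReal.ofReal_mul (multiBeta_pos hT).le]
    congr 1
    have hG : Real.Gamma (∑ i, T i) ≠ 0 := (Real.Gamma_pos_of_pos hTs).ne'
    simp only [multiBeta, Fin.prod_univ_succ (fun i => Real.Gamma (α i)), Fin.sum_univ_succ α]
    simp only [T] at hG ⊢
    field_simp

/-! ### Moments of linear functionals of Dirichlet vectors -/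

/-- Newton's recursion between the coefficients `c` of a power series and the coefficients `p` of
its logarithmic derivative. -/
def IsNewtonSeq (p c : ℕ → ℝ) : Prop :=
  c 0 = 1 ∧ ∀ m : ℕ, (m + 1 : ℝ) * c (m + 1) =
    ∑ ij ∈ Finset.HasAntidiagonal.antidiagonal m, p (ij.1 + 1) * c ij.2

/-- Since m + 1 ≠ 0, each coefficient is determined by the earlier ones. Moments of different laws
can thus be identified without computing them. -/
theorem IsNewtonSeq.unique {p c d : ℕ → ℝ} (hc : IsNewtonSeq p c) (hd : IsNewtonSeq p d) :
    c = d := by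
  funext m
  induction m using Nat.strong_induction_on with
  | _ m ih =>
    cases m with
    | zero => rw [hc.1, hd.1]
    | succ m =>
      have h : (m + 1 : ℝ) * c (m + 1) = (m + 1) * d (m + 1) := by
        rw [hc.2, hd.2]
        refine Finset.sum_congr rfl fun ij hij => ?_
        rw [ih ij.2 (by have := Finset.HasAntidiagonal.mem_antidiagonal.1 hij; omega)]
      exact mul_left_cancel₀ (by positivity) h

/-- The power series of `(1 - s X) ^ (-a)`. -/
noncomputable def negPowSeries (a s : ℝ) : PowerSeries ℝ :=
  PowerSeries.mk fun k => Real.Gamma (a + k) / (Real.Gamma a * k.factorial) * s ^ k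

/-- The logarithmic derivative of (1 - sX)^(-a) is as / (1 - sX), here expanded geometrically. Both
sides are compared after multiplication by the unit 1 - sX. -/
theorem derivative_negPowSeries {a : ℝ} (ha : 0 < a) (s : ℝ) :
    PowerSeries.derivative ℝ (negPowSeries a s) =
      PowerSeries.mk (fun k => a * s ^ (k + 1)) * negPowSeries a s := by
  have hgeo : PowerSeries.mk (fun k => a * s ^ (k + 1)) *
      (1 - PowerSeries.C s * PowerSeries.X) = PowerSeries.C (a * s) := by
    ext n
    cases n with
    | zero => simp
    | succ n =>
      simp only [mul_sub, mul_one, map_sub, ← mul_assoc, PowerSeries.coeff_succ_mul_X,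
        PowerSeries.coeff_mul_C, PowerSeries.coeff_mk, PowerSeries.coeff_C]
      simp
      ring
  have hder : (1 - PowerSeries.C s * PowerSeries.X) *
      PowerSeries.derivative ℝ (negPowSeries a s) = PowerSeries.C (a * s) * negPowSeries a s := by
    have hstep : ∀ n : ℕ, PowerSeries.coeff (n + 1) (negPowSeries a s) * (n + 1) =
        s * (a + n) * PowerSeries.coeff n (negPowSeries a s) := by
      intro n
      have hG : Real.Gamma a ≠ 0 := (Real.Gamma_pos_of_pos ha).ne'
      simp only [negPowSeries, PowerSeries.coeff_mk]
      have : a + ((n + 1 : ℕ) : ℝ) = (a + n) + 1 := by push_cast; ring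
      rw [this, Real.Gamma_add_one (by positivity), Nat.factorial_succ]
      push_cast
      field_simp
      ring
    ext n
    simp only [sub_mul, one_mul, map_sub, mul_assoc, PowerSeries.coeff_C_mul,
      PowerSeries.coeff_derivative]
    rw [hstep]
    cases n with
    | zero => simp; ring
    | succ n =>
      rw [PowerSeries.coeff_succ_X_mul, PowerSeries.coeff_derivative, hstep]
      have := hstep n
      push_cast
      linear_combination s * this
  have hunit : IsUnit (1 - PowerSeries.C s * PowerSeries.X : PowerSeries ℝ) := by
    rw [PowerSeries.isUnit_iff_constantCoeff]
    simp
  refine hunit.mul_left_cancel ?_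
  rw [hder, ← mul_assoc, mul_comm _ (PowerSeries.mk _), hgeo]

/-- Logarithmic derivatives add over products, which produces the weighted power sums. -/
theorem isNewtonSeq_coeff_prod_negPowSeries {ι : Type*} (t : Finset ι) {α : ι → ℝ}
    (hα : ∀ i, 0 < α i) (s : ι → ℝ) :
    IsNewtonSeq (fun j => ∑ i ∈ t, α i * s i ^ j)
      (fun m => PowerSeries.coeff m (∏ i ∈ t, negPowSeries (α i) (s i))) := by
  classical
  have hder : PowerSeries.derivative ℝ (∏ i ∈ t, negPowSeries (α i) (s i)) =
      PowerSeries.mk (fun k => ∑ i ∈ t, α i * s i ^ (k + 1)) *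
        ∏ i ∈ t, negPowSeries (α i) (s i) := by
    induction t using Finset.induction_on with
    | empty =>
      have : (PowerSeries.mk fun _ => (0 : ℝ)) = 0 := by ext; simp
      simp [this]
    | insert a t ha ih =>
      have hmk : PowerSeries.mk (fun k => ∑ i ∈ insert a t, α i * s i ^ (k + 1)) =
          PowerSeries.mk (fun k => α a * s a ^ (k + 1)) +
            PowerSeries.mk (fun k => ∑ i ∈ t, α i * s i ^ (k + 1)) := by
        ext k
        simp [Finset.sum_insert ha]
      rw [Finset.prod_insert ha, Derivation.leibniz, ih, derivative_negPowSeries (hα a), hmk]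
      simp only [smul_eq_mul]
      ring
  refine ⟨?_, fun m => ?_⟩
  · have : ∀ i, Real.Gamma (α i) ≠ 0 := fun i => (Real.Gamma_pos_of_pos (hα i)).ne'
    simp [negPowSeries, map_prod, this]
  · have h := congrArg (PowerSeries.coeff m) hder
    rw [PowerSeries.coeff_derivative, PowerSeries.coeff_mul] at h
    simp only [PowerSeries.coeff_mk] at h
    rw [mul_comm, h]

/-! ### Mass, support and mixed moments of the Dirichlet distribution -/

theorem isProbabilityMeasure_dirichletMeasure {n : ℕ} {α : Fin (n + 1) → ℝ}
    (hα : ∀ i, 0 < α i) : IsProbabilityMeasure (dirichletMeasure α) := by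
  refine ⟨?_⟩
  have hB := multiBeta_pos hα
  rw [dirichletMeasure, Measure.map_apply measurable_simplexPoint MeasurableSet.univ, preimage_univ,
    withDensity_apply _ MeasurableSet.univ, Measure.restrict_univ]
  simp_rw [dirichletPDF_eq_weight_div, div_eq_inv_mul,
    ENNReal.ofReal_mul (inv_nonneg.2 hB.le)]
  rw [lintegral_const_mul' _ _ ENNReal.ofReal_ne_top, lintegral_dirichletWeight α hα,
    ← ENNReal.ofReal_mul (inv_nonneg.2 hB.le), inv_mul_cancel₀ hB.ne', ENNReal.ofReal_one]

theorem measurable_dirichletPDF {n : ℕ} (α : Fin (n + 1) → ℝ) : Measurable (dirichletPDF α) := by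
  simp_rw [funext (dirichletPDF_eq_weight_div α)]
  exact (measurable_dirichletWeight α).div_const _

theorem ae_dirichletMeasure_mem_Icc {n : ℕ} (α : Fin (n + 1) → ℝ) :
    ∀ᵐ y ∂dirichletMeasure α, ∀ i, y i ∈ Icc (0 : ℝ) 1 := by
  have hset : MeasurableSet {y : Fin (n + 1) → ℝ | ∀ i, y i ∈ Icc (0 : ℝ) 1} := by
    have : {y : Fin (n + 1) → ℝ | ∀ i, y i ∈ Icc (0 : ℝ) 1} = ⋂ i, (fun y => y i) ⁻¹' Icc 0 1 := by
      ext; simp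
    rw [this]
    exact MeasurableSet.iInter fun i => measurable_pi_apply i measurableSet_Icc
  rw [dirichletMeasure, ae_map_iff measurable_simplexPoint.aemeasurable hset,
    ae_withDensity_iff (measurable_dirichletPDF α).ennreal_ofReal]
  refine Eventually.of_forall fun z hz => ?_
  have hpos : ∀ i, 0 < simplexPoint z i := by
    by_contra h
    exact hz (by simp [dirichletPDF, h])
  refine fun i => ⟨(hpos i).le, ?_⟩
  rw [← sum_simplexPoint z]
  exact Finset.single_le_sum (f := simplexPoint z) (fun j _ => (hpos j).le) (Finset.mem_univ i)

/-- Multiplying the density by a monomial shifts α to α + k, so the moment is a ratio of two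
Dirichlet integrals. -/
theorem integral_prod_pow_dirichletMeasure {n : ℕ} {α : Fin (n + 1) → ℝ} (hα : ∀ i, 0 < α i)
    (k : Fin (n + 1) → ℕ) :
    ∫ y, ∏ i, y i ^ k i ∂dirichletMeasure α =
      multiBeta (fun i => α i + k i) / multiBeta α := by
  have hB := multiBeta_pos hα
  have hk : ∀ i, 0 < α i + k i := fun i => by have := hα i; positivity
  rw [dirichletMeasure, integral_map measurable_simplexPoint.aemeasurable
    (by fun_prop : Measurable fun y : Fin (n + 1) → ℝ => ∏ i, y i ^ k i).aestronglyMeasurable,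
    integral_withDensity_eq_integral_toReal_smul (measurable_dirichletPDF α).ennreal_ofReal
      (Eventually.of_forall fun _ => ENNReal.ofReal_lt_top)]
  have hpt : ∀ z : Fin n → ℝ, (ENNReal.ofReal (dirichletPDF α z)).toReal •
      ∏ i, simplexPoint z i ^ k i = dirichletWeight (fun i => α i + k i) z / multiBeta α := by
    intro z
    rw [ENNReal.toReal_ofReal (by
      rw [dirichletPDF_eq_weight_div]; exact div_nonneg (dirichletWeight_nonneg _ _) hB.le),
      dirichletPDF_eq_weight_div, smul_eq_mul, div_mul_eq_mul_div]
    congr 1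
    unfold dirichletWeight
    split_ifs with h
    · rw [← Finset.prod_mul_distrib]
      refine Finset.prod_congr rfl fun i _ => ?_
      rw [← Real.rpow_natCast, ← Real.rpow_add (h i)]
      congr 1
      ring
    · simp
  simp_rw [hpt]
  rw [integral_div, integral_eq_lintegral_of_nonneg_ae
    (Eventually.of_forall fun z => dirichletWeight_nonneg _ z)
    (measurable_dirichletWeight _).aestronglyMeasurable, lintegral_dirichletWeight _ hk,
    ENNReal.toReal_ofReal (multiBeta_pos hk).le]

theorem integrable_prod_pow_dirichletMeasure {n : ℕ} {α : Fin (n + 1) → ℝ} (hα : ∀ i, 0 < α i)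
    (k : Fin (n + 1) → ℕ) :
    Integrable (fun y : Fin (n + 1) → ℝ => ∏ i, y i ^ k i) (dirichletMeasure α) := by
  have := isProbabilityMeasure_dirichletMeasure hα
  refine Integrable.of_bound
    (by fun_prop : Measurable fun y : Fin (n + 1) → ℝ => ∏ i, y i ^ k i).aestronglyMeasurable 1 ?_
  filter_upwards [ae_dirichletMeasure_mem_Icc α] with y hy
  rw [Real.norm_of_nonneg (Finset.prod_nonneg fun i _ => pow_nonneg (hy i).1 _)]
  exact Finset.prod_le_one (fun i _ => pow_nonneg (hy i).1 _)
    fun i _ => pow_le_one₀ (hy i).1 (hy i).2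

/-- The normalized moments of a linear functional under the Dirichlet distribution satisfy Newton's
recursion. -/
theorem isNewtonSeq_dirichletMeasure {n : ℕ} {α : Fin (n + 1) → ℝ} (hα : ∀ i, 0 < α i)
    (s : Fin (n + 1) → ℝ) :
    IsNewtonSeq (fun j => ∑ i, α i * s i ^ j)
      (fun m => Real.Gamma ((∑ i, α i) + m) / (Real.Gamma (∑ i, α i) * m.factorial) *
        ∫ y, (∑ i, s i * y i) ^ m ∂dirichletMeasure α) := by
  convert isNewtonSeq_coeff_prod_negPowSeries Finset.univ hα s using 2 with m
  have hb : 0 < ∑ i, α i := Finset.sum_pos (fun i _ => hα i) Finset.univ_nonempty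
  have hGb : Real.Gamma (∑ i, α i) ≠ 0 := (Real.Gamma_pos_of_pos hb).ne'
  have hGbm : Real.Gamma ((∑ i, α i) + m) ≠ 0 := (Real.Gamma_pos_of_pos (by positivity)).ne'
  have hG : ∀ i, Real.Gamma (α i) ≠ 0 := fun i => (Real.Gamma_pos_of_pos (hα i)).ne'
  -- Both the multinomial expansion and the coefficient of a product of series are sums over
  -- multi-indices of weight m. They agree term by term, the prefactor cancelling the Γ of the total
  -- mass.
  simp_rw [Finset.sum_pow_eq_sum_piAntidiag, mul_pow, Finset.prod_mul_distrib, ← mul_assoc]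
  rw [integral_finsetSum _ fun k _ => (integrable_prod_pow_dirichletMeasure hα k).const_mul _]
  simp_rw [integral_const_mul, integral_prod_pow_dirichletMeasure hα]
  rw [PowerSeries.coeff_prod, Finset.mul_sum]
  refine Finset.sum_bij' (fun k _ => Finsupp.equivFunOnFinite.symm k)
    (fun l _ => Finsupp.equivFunOnFinite l) ?_ ?_ ?_ ?_ ?_
  · intro k hk
    simpa [Finset.mem_finsuppAntidiag, Finset.mem_piAntidiag] using hk
  · intro l hl
    have := (Finset.mem_finsuppAntidiag.1 hl).1
    simpa [Finset.mem_piAntidiag] using this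
  · intro k hk; ext; simp
  · intro l hl; ext; simp
  · intro k hk
    have hsum : ∑ i, k i = m := (Finset.mem_piAntidiag.1 hk).1
    have hsumR : ∑ i, (α i + (k i : ℝ)) = (∑ i, α i) + m := by
      rw [Finset.sum_add_distrib, ← hsum]
      push_cast
      rfl
    have hmult : (Nat.multinomial Finset.univ k : ℝ) =
        m.factorial / ∏ i, ((k i).factorial : ℝ) := by
      rw [eq_div_iff (Finset.prod_ne_zero_iff.2 fun i _ => by positivity), mul_comm]
      have := Nat.multinomial_spec Finset.univ k
      rw [hsum] at this
      exact_mod_cast this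
    simp only [negPowSeries, PowerSeries.coeff_mk, Finsupp.equivFunOnFinite_symm_apply_apply,
      multiBeta, hsumR, hmult, Finset.prod_mul_distrib, Finset.prod_div_distrib]
    have h1 : ∏ i, Real.Gamma (α i) ≠ 0 := Finset.prod_ne_zero_iff.2 fun i _ => hG i
    have h2 : ∏ i, ((k i).factorial : ℝ) ≠ 0 :=
      Finset.prod_ne_zero_iff.2 fun i _ => by positivity
    field_simp

/-! ### Sequences of independent identically distributed elements -/

/-- Prepend an element to a sequence. -/
def consSeq {E : Type*} (p : E × (ℕ → E)) : ℕ → E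
  | 0 => p.1
  | n + 1 => p.2 n

theorem measurable_consSeq {E : Type*} [MeasurableSpace E] :
    Measurable (consSeq : E × (ℕ → E) → ℕ → E) := by
  refine measurable_pi_iff.2 fun n => ?_
  cases n with
  | zero => exact measurable_fst
  | succ n => exact (measurable_pi_apply n).comp measurable_snd

/-- An i.i.d. sequence remains one after an independent element of the same law is prepended. It
suffices to test cylinders, which split into their coordinate 0 and a shifted cylinder. -/
theorem measurePreserving_consSeq {E : Type*} [MeasurableSpace E] (μ : Measure E)
    [IsProbabilityMeasure μ] :
    MeasurePreserving consSeq (μ.prod (Measure.infinitePi fun _ : ℕ => μ))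
      (Measure.infinitePi fun _ : ℕ => μ) := by
  refine ⟨measurable_consSeq, Measure.eq_infinitePi _ fun s t ht => ?_⟩
  rw [Measure.map_apply measurable_consSeq (.pi s.countable_toSet fun i _ => ht i)]
  let s' : Finset ℕ := s.preimage Nat.succ Nat.succ_injective.injOn
  let t0 : Set E := if 0 ∈ s then t 0 else univ
  have hpre : consSeq ⁻¹' (s : Set ℕ).pi t = t0 ×ˢ (s' : Set ℕ).pi fun n => t (n + 1) := by
    ext p
    simp only [mem_preimage, Set.mem_pi, mem_prod, s', t0, Finset.coe_preimage, Finset.mem_coe]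
    constructor
    · intro h
      refine ⟨?_, fun n hn => h (n + 1) hn⟩
      split_ifs with h0
      · exact h 0 h0
      · trivial
    · rintro ⟨h0, h1⟩ n hn
      cases n with
      | zero => simpa [hn, consSeq] using h0
      | succ n => exact h1 n hn
  rw [hpre, Measure.prod_prod, Measure.infinitePi_pi _ fun i _ => ht (i + 1)]
  have hs' : ∏ i ∈ s', μ (t (i + 1)) = ∏ i ∈ s.erase 0, μ (t i) := by
    rw [← Finset.prod_preimage Nat.succ (s.erase 0) Nat.succ_injective.injOn fun i => μ (t i)]
    · refine Finset.prod_congr ?_ fun _ _ => rfl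
      ext n
      simp [s']
    · intro x hx hxr
      exact absurd (by simpa [Nat.range_succ, Nat.pos_iff_ne_zero] using (Finset.mem_erase.1 hx).1)
        hxr
  rw [hs']
  by_cases h0 : 0 ∈ s
  · simp only [t0, if_pos h0]
    exact Finset.mul_prod_erase s (fun i => μ (t i)) h0
  · simp [t0, if_neg h0, Finset.erase_eq_of_notMem h0]

/-! ### Stick breaking -/

section StickBreaking

variable {X : Type*}

/-- The length of the stick left after `n` breaks, where `(ω j).1` is the fraction kept at the
`j`-th break. -/
noncomputable def stickResidual (ω : ℕ → unitInterval × X) (n : ℕ) : ENNReal :=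
  ∏ j ∈ Finset.range n, ENNReal.ofReal (ω j).1

/-- The length of the piece broken off at the `n`-th break. -/
noncomputable def stickWeight (ω : ℕ → unitInterval × X) (n : ℕ) : ENNReal :=
  stickResidual ω n * ENNReal.ofReal (1 - (ω n).1)

theorem sum_stickWeight_add_stickResidual (ω : ℕ → unitInterval × X) (n : ℕ) :
    ∑ i ∈ Finset.range n, stickWeight ω i + stickResidual ω n = 1 := by
  induction n with
  | zero => simp [stickResidual]
  | succ n ih =>
    have h : stickWeight ω n + stickResidual ω (n + 1) = stickResidual ω n := by
      rw [stickWeight, stickResidual, stickResidual, Finset.prod_range_succ, ← mul_add,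
        ← ENNReal.ofReal_add (by linarith [(ω n).1.2.2]) (ω n).1.2.1]
      simp
    rw [Finset.sum_range_succ, add_assoc, h, ih]

theorem tsum_stickWeight_le_one (ω : ℕ → unitInterval × X) : ∑' n, stickWeight ω n ≤ 1 :=
  ENNReal.tsum_le_of_sum_range_le fun n =>
    le_self_add.trans (sum_stickWeight_add_stickResidual ω n).le

/-- The power `u ^ (1 / β)`; it has law `Beta(β, 1)` if `u` is uniform. -/
noncomputable def betaFraction (β : ℝ) (u : unitInterval) : unitInterval :=
  -- The absolute value keeps the power in the unit interval for every real β; it disappears for β >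
  -- 0.
  ⟨(u : ℝ) ^ |β⁻¹|, Real.rpow_nonneg u.2.1 _, Real.rpow_le_one u.2.1 u.2.2 (abs_nonneg _)⟩

/-- Sequences of uniform variables turned into sequences of `Beta(β, 1)` variables. -/
noncomputable def betaSeq (β : ℝ) (ω : ℕ → unitInterval × X) : ℕ → unitInterval × X :=
  fun n => (betaFraction β (ω n).1, (ω n).2)

theorem betaSeq_consSeq (β : ℝ) (p : (unitInterval × X) × (ℕ → unitInterval × X)) :
    betaSeq β (consSeq p) = consSeq ((betaFraction β p.1.1, p.1.2), betaSeq β p.2) := by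
  funext n
  cases n <;> rfl

variable [MeasurableSpace X]

/-- The stick-breaking measure with atoms `(ω n).2`; the part of the stick that is never broken
off, if any, is distributed according to `σ`. -/
noncomputable def stickMeasure (σ : Measure X) (ω : ℕ → unitInterval × X) : Measure X :=
  Measure.sum (fun n => stickWeight ω n • Measure.dirac (ω n).2) +
    (1 - ∑' n, stickWeight ω n) • σ

instance isProbabilityMeasure_stickMeasure (σ : Measure X) [IsProbabilityMeasure σ]
    (ω : ℕ → unitInterval × X) : IsProbabilityMeasure (stickMeasure σ ω) := by
  refine ⟨?_⟩
  simp [stickMeasure, add_tsub_cancel_of_le (tsum_stickWeight_le_one ω)]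

theorem measurable_stickWeight (n : ℕ) :
    Measurable fun ω : ℕ → unitInterval × X => stickWeight ω n := by
  unfold stickWeight stickResidual
  fun_prop

theorem measurable_stickMeasure (σ : Measure X) :
    Measurable fun ω : ℕ → unitInterval × X => stickMeasure σ ω := by
  refine Measure.measurable_of_measurable_coe _ fun s hs => ?_
  simp only [stickMeasure, Measure.add_apply, Measure.sum_apply _ hs, Measure.smul_apply,
    smul_eq_mul]
  refine Measurable.add (Measurable.tsum fun n => ?_) ?_
  · exact (measurable_stickWeight n).mul ((Measure.measurable_coe hs).comp
      (Measure.measurable_dirac.comp (by fun_prop)))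
  · exact (measurable_const.sub (Measurable.tsum fun n => measurable_stickWeight n)).mul_const _

/-- The self-similarity of stick breaking. It holds for every sequence because the mass never broken
off is also multiplied by the first kept fraction. -/
theorem stickMeasure_consSeq (σ : Measure X) (p : (unitInterval × X) × (ℕ → unitInterval × X)) :
    stickMeasure σ (consSeq p) =
      ENNReal.ofReal (1 - p.1.1) • Measure.dirac p.1.2 +
        ENNReal.ofReal p.1.1 • stickMeasure σ p.2 := by
  have h0 : stickWeight (consSeq p) 0 = ENNReal.ofReal (1 - p.1.1) := by
    simp [stickWeight, stickResidual, consSeq]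
  have hs : ∀ n, stickWeight (consSeq p) (n + 1) = ENNReal.ofReal p.1.1 * stickWeight p.2 n := by
    intro n
    simp [stickWeight, stickResidual, Finset.prod_range_succ', consSeq]
    ring
  have hrem : 1 - ∑' n, stickWeight (consSeq p) n =
      ENNReal.ofReal p.1.1 * (1 - ∑' n, stickWeight p.2 n) := by
    rw [tsum_eq_zero_add' ENNReal.summable, h0]
    simp_rw [hs]
    rw [ENNReal.tsum_mul_left, ENNReal.mul_sub (fun _ _ => ENNReal.ofReal_ne_top), mul_one,
      tsub_add_eq_tsub_tsub]
    congr 1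
    rw [← ENNReal.ofReal_one, ← ENNReal.ofReal_sub _ (by linarith [p.1.1.2.2])]
    simp
  ext s hs'
  simp only [stickMeasure, Measure.add_apply, Measure.sum_apply _ hs', Measure.smul_apply,
    smul_eq_mul, hrem]
  rw [tsum_eq_zero_add' ENNReal.summable, h0]
  simp_rw [hs, mul_assoc]
  rw [ENNReal.tsum_mul_left]
  simp only [consSeq]
  ring

theorem integrable_of_bounded {μ : Measure X} [IsFiniteMeasure μ] {f : X → ℝ} (hf : Measurable f)
    {C : ℝ} (hC : ∀ x, |f x| ≤ C) : Integrable f μ :=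
  Integrable.of_bound hf.aestronglyMeasurable C (Eventually.of_forall hC)

theorem integral_stickMeasure_consSeq (σ : Measure X) [IsProbabilityMeasure σ]
    {f : X → ℝ} (hf : Measurable f) {C : ℝ} (hC : ∀ x, |f x| ≤ C)
    (p : (unitInterval × X) × (ℕ → unitInterval × X)) :
    ∫ x, f x ∂stickMeasure σ (consSeq p) =
      (1 - p.1.1) * f p.1.2 + p.1.1 * ∫ x, f x ∂stickMeasure σ p.2 := by
  rw [stickMeasure_consSeq, integral_add_measure
    ((integrable_of_bounded hf hC).smul_measure ENNReal.ofReal_ne_top)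
    ((integrable_of_bounded hf hC).smul_measure ENNReal.ofReal_ne_top), integral_smul_measure,
    integral_smul_measure, integral_dirac' _ _ hf.stronglyMeasurable,
    ENNReal.toReal_ofReal (by linarith [p.1.1.2.2]), ENNReal.toReal_ofReal p.1.1.2.1]
  rfl

/-! ### The random stick-breaking measure and the moments of its means -/

/-- The law of a sequence of independent pairs of a uniform variable and a point with law `σ`. -/
noncomputable def stickLaw (σ : Measure X) : Measure (ℕ → unitInterval × X) :=
  Measure.infinitePi fun _ => (volume : Measure unitInterval).prod σ

instance isProbabilityMeasure_stickLaw (σ : Measure X) [IsProbabilityMeasure σ] :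
    IsProbabilityMeasure (stickLaw σ) := by
  unfold stickLaw; infer_instance

theorem measurable_betaFraction (β : ℝ) : Measurable (betaFraction β) :=
  Measurable.subtype_mk (measurable_subtype_coe.pow_const _)

/-- The value is β B(β + a, j + 1), as expected for the density β v^(β-1). Writing (1 - v)^(j+1) v^a
as a difference reduces j to 0, where the integral is that of u^(a/β). -/
theorem integral_betaFraction {β : ℝ} (hβ : 0 < β) (a j : ℕ) :
    ∫ u : unitInterval, (1 - (betaFraction β u : ℝ)) ^ j * (betaFraction β u : ℝ) ^ a =
      β * j.factorial * Real.Gamma (β + a) / Real.Gamma (β + a + j + 1) := by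
  have hint : ∀ a j : ℕ, Integrable
      fun u : unitInterval => (1 - (betaFraction β u : ℝ)) ^ j * (betaFraction β u : ℝ) ^ a := by
    intro a j
    have hm : Measurable fun u : unitInterval => (betaFraction β u : ℝ) :=
      measurable_subtype_coe.comp (measurable_betaFraction β)
    refine integrable_of_bounded (by fun_prop) (C := 1) fun u => ?_
    have h0 := (betaFraction β u).2.1
    have h1 := (betaFraction β u).2.2
    rw [abs_of_nonneg (mul_nonneg (pow_nonneg (by linarith) _) (pow_nonneg h0 _))]
    exact mul_le_one₀ (pow_le_one₀ (by linarith) (by linarith)) (pow_nonneg h0 _)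
      (pow_le_one₀ h0 h1)
  induction j generalizing a with
  | zero =>
    have h1 : ∀ u : unitInterval, (1 - (betaFraction β u : ℝ)) ^ 0 * (betaFraction β u : ℝ) ^ a =
        (fun x : ℝ => x ^ (a / β)) u := by
      intro u
      simp only [betaFraction, pow_zero, one_mul, abs_of_pos (inv_pos.2 hβ)]
      rw [← Real.rpow_natCast, ← Real.rpow_mul u.2.1]
      congr 1
      field_simp
    simp_rw [h1]
    rw [unitInterval.volume_def,
      integral_subtype_comap measurableSet_Icc (fun x : ℝ => x ^ ((a : ℝ) / β)),
      integral_Icc_eq_integral_Ioc,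
      ← intervalIntegral.integral_of_le zero_le_one, integral_rpow (Or.inl ?_)]
    · have hG : Real.Gamma (β + a) ≠ 0 := (Real.Gamma_pos_of_pos (by positivity)).ne'
      have hpos : (0 : ℝ) < a / β + 1 := by positivity
      rw [Real.one_rpow, Real.zero_rpow hpos.ne']
      simp only [Nat.factorial_zero, Nat.cast_one, Nat.cast_zero, add_zero]
      rw [Real.Gamma_add_one (by positivity)]
      field_simp
      ring
    · have : (0 : ℝ) ≤ a / β := by positivity
      linarith
  | succ j ih =>
    have h1 : ∀ u : unitInterval, (1 - (betaFraction β u : ℝ)) ^ (j + 1) *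
        (betaFraction β u : ℝ) ^ a =
        (1 - (betaFraction β u : ℝ)) ^ j * (betaFraction β u : ℝ) ^ a -
          (1 - (betaFraction β u : ℝ)) ^ j * (betaFraction β u : ℝ) ^ (a + 1) := by
      intro u; ring
    simp_rw [h1]
    rw [integral_sub (hint _ _) (hint _ _), ih, ih]
    have e1 : β + ((a + 1 : ℕ) : ℝ) = (β + a) + 1 := by push_cast; ring
    have e2 : β + (a : ℝ) + 1 + j + 1 = (β + a + j + 1) + 1 := by ring
    have e3 : β + (a : ℝ) + ((j + 1 : ℕ) : ℝ) + 1 = (β + a + j + 1) + 1 := by push_cast; ring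
    rw [e1, e2, e3, Real.Gamma_add_one (s := β + a) (by positivity),
      Real.Gamma_add_one (s := β + a + j + 1) (by positivity), Nat.factorial_succ]
    have hG : Real.Gamma (β + a + j + 1) ≠ 0 := (Real.Gamma_pos_of_pos (by positivity)).ne'
    push_cast
    field_simp
    ring

theorem measurable_betaSeq (β : ℝ) :
    Measurable (betaSeq β : (ℕ → unitInterval × X) → ℕ → unitInterval × X) :=
  measurable_pi_iff.2 fun n =>
    ((measurable_betaFraction β).comp (by fun_prop)).prodMk (by fun_prop)

/-- The stick-breaking random probability with parameters `β` and `σ`. -/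
noncomputable def stickProba (β : ℝ) (σ : ProbabilityMeasure X) (ω : ℕ → unitInterval × X) :
    ProbabilityMeasure X :=
  ⟨stickMeasure σ (betaSeq β ω), inferInstance⟩

theorem measurable_stickProba (β : ℝ) (σ : ProbabilityMeasure X) :
    Measurable (stickProba β σ) :=
  Measurable.subtype_mk ((measurable_stickMeasure _).comp (measurable_betaSeq β))

/-- The law of the stick-breaking random probability. -/
noncomputable def stickFerguson (β : ℝ) (σ : ProbabilityMeasure X) :
    ProbabilityMeasure (ProbabilityMeasure X) :=
  ProbabilityMeasure.map ⟨stickLaw (σ : Measure X), inferInstance⟩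
    (measurable_stickProba β σ).aemeasurable

theorem integral_stickProba_consSeq (β : ℝ) (σ : ProbabilityMeasure X)
    {f : X → ℝ} (hf : Measurable f) {C : ℝ} (hC : ∀ x, |f x| ≤ C)
    (p : (unitInterval × X) × (ℕ → unitInterval × X)) :
    ∫ x, f x ∂(stickProba β σ (consSeq p) : Measure X) =
      (1 - betaFraction β p.1.1) * f p.1.2 +
        betaFraction β p.1.1 * ∫ x, f x ∂(stickProba β σ p.2 : Measure X) := by
  change ∫ x, f x ∂stickMeasure σ (betaSeq β (consSeq p)) = _
  rw [betaSeq_consSeq, integral_stickMeasure_consSeq _ hf hC]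
  rfl

theorem measurable_integral_probabilityMeasure {E : Type*} [NormedAddCommGroup E]
    [NormedSpace ℝ E] [MeasurableSpace E] [BorelSpace E] {f : X → E} (hf : StronglyMeasurable f) :
    Measurable fun η : ProbabilityMeasure X => ∫ x, f x ∂(η : Measure X) :=
  (hf.integral_kernel
    (κ := (⟨fun η : ProbabilityMeasure X => (η : Measure X), measurable_subtype_coe⟩ :
      ProbabilityTheory.Kernel (ProbabilityMeasure X) X))).measurable

theorem abs_integral_le_of_bounded {μ : Measure X} [IsProbabilityMeasure μ] {f : X → ℝ} {C : ℝ}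
    (hC : ∀ x, |f x| ≤ C) : |∫ x, f x ∂μ| ≤ C := by
  simpa using norm_integral_le_of_norm_le_const (μ := μ) (f := f) (Eventually.of_forall hC)

theorem integral_stickFerguson {E : Type*} [NormedAddCommGroup E] [NormedSpace ℝ E]
    (β : ℝ) (σ : ProbabilityMeasure X) {F : ProbabilityMeasure X → E}
    (hF : StronglyMeasurable F) :
    ∫ η, F η ∂(stickFerguson β σ : Measure (ProbabilityMeasure X)) =
      ∫ ω, F (stickProba β σ ω) ∂stickLaw (σ : Measure X) := by
  change ∫ η, F η ∂((stickLaw (σ : Measure X)).map (stickProba β σ)) = _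
  rw [integral_map (measurable_stickProba β σ).aemeasurable hF.aestronglyMeasurable]

theorem integral_stickLaw {E : Type*} [NormedAddCommGroup E] [NormedSpace ℝ E]
    (σ : Measure X) [IsProbabilityMeasure σ] {F : (ℕ → unitInterval × X) → E}
    (hF : StronglyMeasurable F) :
    ∫ ω, F ω ∂stickLaw σ =
      ∫ p, F (consSeq p) ∂(((volume : Measure unitInterval).prod σ).prod (stickLaw σ)) := by
  have h := measurePreserving_consSeq ((volume : Measure unitInterval).prod σ)
  change MeasurePreserving consSeq _ (stickLaw σ) at h
  have hi := integral_map (μ := ((volume : Measure unitInterval).prod σ).prod (stickLaw σ))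
    h.measurable.aemeasurable (f := F) hF.aestronglyMeasurable
  exact (congrArg (fun ν => ∫ ω, F ω ∂ν) h.map_eq.symm).trans hi

/-- The normalized moments of the random mean `η f` satisfy Newton's recursion. -/
theorem isNewtonSeq_stickFerguson {β : ℝ} (hβ : 0 < β) (σ : ProbabilityMeasure X)
    {f : X → ℝ} (hf : Measurable f) {C : ℝ} (hC : ∀ x, |f x| ≤ C) :
    IsNewtonSeq (fun j => β * ∫ x, f x ^ j ∂(σ : Measure X))
      (fun m => Real.Gamma (β + m) / (Real.Gamma β * m.factorial) *
        ∫ η : ProbabilityMeasure X, (∫ x, f x ∂(η : Measure X)) ^ m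
          ∂(stickFerguson β σ : Measure (ProbabilityMeasure X))) := by
  have hmη := measurable_integral_probabilityMeasure hf.stronglyMeasurable
  have hGβ : Real.Gamma β ≠ 0 := (Real.Gamma_pos_of_pos hβ).ne'
  set H : ℕ → ℝ := fun m => ∫ ω, (∫ x, f x ∂(stickProba β σ ω : Measure X)) ^ m
    ∂stickLaw (σ : Measure X) with hH
  have hHeq : ∀ m, ∫ η : ProbabilityMeasure X, (∫ x, f x ∂(η : Measure X)) ^ m
      ∂(stickFerguson β σ : Measure (ProbabilityMeasure X)) = H m := fun m =>
    integral_stickFerguson β σ (hmη.pow_const m).stronglyMeasurable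
  simp_rw [hHeq]
  have hmZ : Measurable fun ω => ∫ x, f x ∂(stickProba β σ ω : Measure X) :=
    hmη.comp (measurable_stickProba β σ)
  have hC0 : 0 ≤ C := by
    obtain ⟨x⟩ := σ.nonempty
    exact (abs_nonneg _).trans (hC x)
  -- Binomial expansion of ((1 - V) f(x) + V η'f)^m, with V, x and η' independent. `H m` itself
  -- occurs on the right, in the term `ij.1 = 0`.
  have hrec : ∀ m, H m = ∑ ij ∈ Finset.HasAntidiagonal.antidiagonal m,
      (m.choose ij.1 : ℝ) * ((β * ij.1.factorial * Real.Gamma (β + ij.2) /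
        Real.Gamma (β + ij.2 + ij.1 + 1)) * (∫ x, f x ^ ij.1 ∂(σ : Measure X)) * H ij.2) := by
    intro m
    have hmB : Measurable fun u : unitInterval => (betaFraction β u : ℝ) :=
      measurable_subtype_coe.comp (measurable_betaFraction β)
    rw [hH]
    simp only
    rw [integral_stickLaw _ (hmZ.pow_const m).stronglyMeasurable]
    have hpow : ∀ x y : ℝ, (x + y) ^ m = ∑ ij ∈ Finset.HasAntidiagonal.antidiagonal m,
        (m.choose ij.1 : ℝ) * (x ^ ij.1 * y ^ ij.2) := fun x y => by
      simpa only [nsmul_eq_mul] using (Commute.all x y).add_pow' m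
    simp_rw [integral_stickProba_consSeq β σ hf hC, hpow]
    rw [integral_finsetSum]
    · refine Finset.sum_congr rfl fun ij _ => ?_
      rw [integral_const_mul]
      congr 1
      let A : unitInterval → ℝ := fun u =>
        (1 - (betaFraction β u : ℝ)) ^ ij.1 * (betaFraction β u : ℝ) ^ ij.2
      let B : X → ℝ := fun x => f x ^ ij.1
      let Z : (ℕ → unitInterval × X) → ℝ := fun ω =>
        (∫ x, f x ∂(stickProba β σ ω : Measure X)) ^ ij.2
      have e1 := integral_prod_mul (μ := (volume : Measure unitInterval).prod (σ : Measure X))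
        (ν := stickLaw (σ : Measure X)) (fun q => A q.1 * B q.2) Z
      have e2 := integral_prod_mul (μ := (volume : Measure unitInterval)) (ν := (σ : Measure X)) A B
      rw [e2, integral_betaFraction hβ] at e1
      refine Eq.trans (integral_congr_ae (Eventually.of_forall fun p => ?_)) e1
      simp only [mul_pow, A, B, Z]
      ring
    · intro ij _
      refine Integrable.const_mul ?_ _
      refine integrable_of_bounded (C := C ^ ij.1 * C ^ ij.2) ?_ fun p => ?_
      · have h1 := hmB.comp (measurable_fst.comp measurable_fst :
          Measurable fun p : (unitInterval × X) × (ℕ → unitInterval × X) => p.1.1)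
        have h2 := hf.comp (measurable_snd.comp measurable_fst :
          Measurable fun p : (unitInterval × X) × (ℕ → unitInterval × X) => p.1.2)
        have h3 := hmZ.comp (measurable_snd :
          Measurable fun p : (unitInterval × X) × (ℕ → unitInterval × X) => p.2)
        exact (((measurable_const.sub h1).mul h2).pow_const _).mul ((h1.mul h3).pow_const _)
      · have h0 := (betaFraction β p.1.1).2.1
        have h1 := (betaFraction β p.1.1).2.2
        rw [abs_mul, abs_pow, abs_pow, abs_mul, abs_mul]
        refine mul_le_mul (pow_le_pow_left₀ (by positivity) ?_ _)
          (pow_le_pow_left₀ (by positivity) ?_ _) (by positivity) (by positivity)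
        · rw [abs_of_nonneg (by linarith)]
          calc _ ≤ 1 * C := mul_le_mul (by linarith) (hC _) (abs_nonneg _) zero_le_one
            _ = C := one_mul C
        · rw [abs_of_nonneg h0]
          calc _ ≤ 1 * C := mul_le_mul h1 (abs_integral_le_of_bounded hC) (abs_nonneg _) zero_le_one
            _ = C := one_mul C
  refine ⟨by simp [hH, hGβ], fun m => ?_⟩
  have hpos : 0 < β + ((m : ℝ) + 1) := by positivity
  have hGm : Real.Gamma (β + ((m : ℝ) + 1)) ≠ 0 := (Real.Gamma_pos_of_pos hpos).ne'
  set c : ℕ → ℝ := fun m => Real.Gamma (β + m) / (Real.Gamma β * m.factorial) * H m with hc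
  have hfull : (β + ((m : ℝ) + 1)) * c (m + 1) =
      ∑ ij ∈ Finset.HasAntidiagonal.antidiagonal (m + 1),
        β * (∫ x, f x ^ ij.1 ∂(σ : Measure X)) * c ij.2 := by
    have : c (m + 1) = Real.Gamma (β + ((m : ℝ) + 1)) / (Real.Gamma β * (m + 1).factorial) *
        H (m + 1) := by simp [hc]
    rw [this, hrec (m + 1), Finset.mul_sum, Finset.mul_sum]
    refine Finset.sum_congr rfl fun ij hij => ?_
    have hij' : ij.1 + ij.2 = m + 1 := Finset.HasAntidiagonal.mem_antidiagonal.1 hij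
    have hijR : (ij.2 : ℝ) + ij.1 = m + 1 := by rw [add_comm]; exact_mod_cast hij'
    have e1 : β + (ij.2 : ℝ) + ij.1 + 1 = (β + ((m : ℝ) + 1)) + 1 := by rw [← hijR]; ring
    have hch : ((m + 1).choose ij.1 : ℝ) * (ij.1.factorial * ij.2.factorial) =
        (m + 1).factorial := by
      have := Nat.choose_mul_factorial_mul_factorial (show ij.1 ≤ m + 1 by omega)
      rw [show m + 1 - ij.1 = ij.2 by omega, mul_assoc] at this
      exact_mod_cast this
    have hfac : ((m + 1).factorial : ℝ) ≠ 0 := by positivity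
    have hfac2 : (ij.2.factorial : ℝ) ≠ 0 := by positivity
    rw [e1, Real.Gamma_add_one hpos.ne']
    simp only [hc]
    field_simp
    rw [← hch]
    ring
  -- The term with `ij.1 = 0` is β c(m+1); moving it to the left turns the factor β + m + 1 into m +
  -- 1.
  rw [Finset.Nat.sum_antidiagonal_succ] at hfull
  simp only [pow_zero, integral_const, probReal_univ, smul_eq_mul, mul_one] at hfull
  linarith

end StickBreaking

/-! ### Measures determined by moments -/

/-- Boundedness of `Z` lets the exponential series be integrated termwise, so the characteristic
function at 1 depends only on the moments. -/
theorem hasSum_integral_cexp {Ω : Type*} [MeasurableSpace Ω] (μ : Measure Ω)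
    [IsProbabilityMeasure μ] {Z : Ω → ℝ} (hZ : Measurable Z) {C : ℝ}
    (hC : ∀ᵐ ω ∂μ, |Z ω| ≤ C) :
    HasSum (fun n : ℕ => Complex.I ^ n / n.factorial * ((∫ ω, Z ω ^ n ∂μ : ℝ) : ℂ))
      (∫ ω, Complex.exp (Z ω * Complex.I) ∂μ) := by
  have hC0 : 0 ≤ C := by
    obtain ⟨ω, hω⟩ := hC.exists
    exact (abs_nonneg _).trans hω
  have h := hasSum_integral_of_dominated_convergence (μ := μ)
    (F := fun (n : ℕ) ω => ((Z ω : ℂ) * Complex.I) ^ n / n.factorial)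
    (f := fun ω => Complex.exp (Z ω * Complex.I)) (fun n _ => C ^ n / n.factorial)
    (fun n => by fun_prop) (fun n => ?_) ?_ ?_ ?_
  · refine (congrArg (fun a => HasSum a _) (funext fun n => ?_)).mp h
    have : ∀ ω, ((Z ω : ℂ) * Complex.I) ^ n / n.factorial =
        Complex.I ^ n / n.factorial * ((Z ω ^ n : ℝ) : ℂ) := by
      intro ω
      push_cast
      ring
    simp_rw [this]
    rw [integral_const_mul]
    exact congrArg _ integral_ofReal
  · filter_upwards [hC] with ω hω
    simp only [norm_div, norm_pow, norm_mul, Complex.norm_real, Complex.norm_I, mul_one,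
      Complex.norm_natCast, Real.norm_eq_abs]
    gcongr
  · exact Eventually.of_forall fun _ => Real.summable_pow_div_factorial C
  · exact integrable_const _
  · refine Eventually.of_forall fun ω => ?_
    rw [Complex.exp_eq_exp_ℂ]
    exact NormedSpace.expSeries_div_hasSum_exp _

/-- Every linear functional is bounded on the cube, so its moments give its characteristic function,
and these together determine the measure. -/
theorem ext_of_integral_pow {ι : Type*} [Fintype ι] {μ ν : Measure (ι → ℝ)}
    [IsProbabilityMeasure μ] [IsProbabilityMeasure ν] (hμ : ∀ᵐ y ∂μ, ∀ i, y i ∈ Icc (0 : ℝ) 1)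
    (hν : ∀ᵐ y ∂ν, ∀ i, y i ∈ Icc (0 : ℝ) 1)
    (h : ∀ (s : ι → ℝ) (m : ℕ), ∫ y, (∑ i, s i * y i) ^ m ∂μ = ∫ y, (∑ i, s i * y i) ^ m ∂ν) :
    μ = ν := by
  classical
  refine Measure.ext_of_charFunDual ?_
  funext L
  let s : ι → ℝ := fun i => L (Pi.single i 1)
  have hL : ∀ y, L y = ∑ i, s i * y i := by
    intro y
    have := LinearMap.pi_apply_eq_sum_univ (L : (ι → ℝ) →ₗ[ℝ] ℝ) y
    simp only [smul_eq_mul, ContinuousLinearMap.coe_coe] at this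
    rw [this]
    refine Finset.sum_congr rfl fun i _ => ?_
    rw [mul_comm]
    congr 2
    funext j
    simp [Pi.single_apply, eq_comm]
  have hb : ∀ y : ι → ℝ, (∀ i, y i ∈ Icc (0 : ℝ) 1) → |L y| ≤ ∑ i, |s i| := by
    intro y hy
    rw [hL]
    refine (Finset.abs_sum_le_sum_abs _ _).trans (Finset.sum_le_sum fun i _ => ?_)
    rw [abs_mul, abs_of_nonneg (hy i).1]
    exact mul_le_of_le_one_right (abs_nonneg _) (hy i).2
  have h1 := hasSum_integral_cexp μ (Z := fun y => L y) L.continuous.measurable (hμ.mono hb)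
  have h2 := hasSum_integral_cexp ν (Z := fun y => L y) L.continuous.measurable (hν.mono hb)
  rw [charFunDual_apply, charFunDual_apply]
  refine h1.unique ?_
  convert h2 using 4 with n
  simp_rw [hL]
  rw [h s n]

/-! ### Existence of the Dirichlet--Ferguson measure -/

section DirichletFerguson

variable {X : Type*} [MeasurableSpace X]

theorem measurable_real_apply {A : Set X} (hA : MeasurableSet A) :
    Measurable fun η : ProbabilityMeasure X => (η : Measure X).real A :=
  ((Measure.measurable_coe hA).comp measurable_subtype_coe).ennreal_toReal

/-- The index is that of the cell containing x. That it serves all coefficients at once allows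
powers of a simple function to be taken coefficientwise. -/
theorem IsNontrivialPartition.sum_indicator_eq {σ : Measure X} {k : ℕ} {A : Fin k → Set X}
    (hA : IsNontrivialPartition σ A) (x : X) :
    ∃ i, ∀ s : Fin k → ℝ, ∑ j, s j * (A j).indicator 1 x = s i := by
  obtain ⟨i, hi⟩ := mem_iUnion.1 (hA.iUnion_eq.symm ▸ mem_univ x)
  refine ⟨i, fun s => ?_⟩
  rw [Finset.sum_eq_single i]
  · simp [hi]
  · intro j _ hj
    simp [(hA.disjoint i j hj.symm).notMem_of_mem_left hi]
  · simp

theorem integral_sum_indicator (μ : Measure X) [IsFiniteMeasure μ] {k : ℕ} {A : Fin k → Set X}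
    (hA : ∀ i, MeasurableSet (A i)) (s : Fin k → ℝ) :
    ∫ x, ∑ j, s j * (A j).indicator 1 x ∂μ = ∑ j, s j * μ.real (A j) := by
  rw [integral_finsetSum]
  · refine Finset.sum_congr rfl fun j _ => ?_
    rw [integral_const_mul, integral_indicator_one (hA j)]
  · intro j _
    refine Integrable.const_mul ?_ _
    exact (integrable_const (1 : ℝ)).indicator (hA j)

theorem integral_stickFerguson_of_partition {β : ℝ} (hβ : 0 < β) (σ : ProbabilityMeasure X)
    {n : ℕ} {A : Fin (n + 1) → Set X} (hA : IsNontrivialPartition (σ : Measure X) A)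
    (s : Fin (n + 1) → ℝ) (m : ℕ) :
    ∫ η : ProbabilityMeasure X, (∑ i, s i * (η : Measure X).real (A i)) ^ m
        ∂(stickFerguson β σ : Measure (ProbabilityMeasure X)) =
      ∫ y, (∑ i, s i * y i) ^ m
        ∂dirichletMeasure (fun i => β * (σ : Measure X).real (A i)) := by
  have hα : ∀ i, 0 < β * (σ : Measure X).real (A i) := fun i =>
    mul_pos hβ (ENNReal.toReal_pos (hA.pos i).ne' (measure_ne_top _ _))
  let f : X → ℝ := fun x => ∑ j, s j * (A j).indicator 1 x
  have hf : Measurable f := Finset.measurable_sum _ fun j _ =>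
    (measurable_one.indicator (hA.measurableSet j)).const_mul _
  have hfC : ∀ x, |f x| ≤ ∑ j, |s j| := by
    intro x
    obtain ⟨i, hi⟩ := hA.sum_indicator_eq x
    simp only [f, hi]
    exact Finset.single_le_sum (f := fun j => |s j|) (fun j _ => abs_nonneg _) (Finset.mem_univ i)
  have hp : (fun j : ℕ => β * ∫ x, f x ^ j ∂(σ : Measure X)) =
      fun j => ∑ i, β * (σ : Measure X).real (A i) * s i ^ j := by
    funext j
    have hpow : ∀ x, f x ^ j = ∑ i, s i ^ j * (A i).indicator 1 x := by
      intro x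
      obtain ⟨i, hi⟩ := hA.sum_indicator_eq x
      rw [hi fun i => s i ^ j]
      simp only [f, hi]
    simp_rw [hpow]
    rw [integral_sum_indicator _ hA.measurableSet, Finset.mul_sum]
    exact Finset.sum_congr rfl fun i _ => by ring
  -- The equality of power sums at exponent 0 is the equality of total masses.
  have hsum : ∑ i, β * (σ : Measure X).real (A i) = β := by
    have := congrFun hp 0
    simpa using this.symm
  have h1 := isNewtonSeq_stickFerguson hβ σ hf hfC
  rw [hp] at h1
  have h2 := congrFun (h1.unique (isNewtonSeq_dirichletMeasure hα s)) m
  simp only [hsum] at h2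
  have hG : Real.Gamma (β + m) ≠ 0 := (Real.Gamma_pos_of_pos (by positivity)).ne'
  have hG' : Real.Gamma β ≠ 0 := (Real.Gamma_pos_of_pos hβ).ne'
  have h3 := mul_left_cancel₀ (by positivity) h2
  rw [← h3]
  refine integral_congr_ae (Eventually.of_forall fun η => ?_)
  simp only [f, integral_sum_indicator _ hA.measurableSet]

theorem isDirichletFerguson_stickFerguson {β : ℝ} (hβ : 0 < β) (σ : ProbabilityMeasure X) :
    IsDirichletFerguson β σ (stickFerguson β σ) where
  map_eval n A hA := by
    have hm : Measurable fun (η : ProbabilityMeasure X) (i : Fin (n + 1)) =>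
        (η : Measure X).real (A i) :=
      measurable_pi_iff.2 fun i => measurable_real_apply (hA.measurableSet i)
    have hα : ∀ i, 0 < β * (σ : Measure X).real (A i) := fun i =>
      mul_pos hβ (ENNReal.toReal_pos (hA.pos i).ne' (measure_ne_top _ _))
    have := isProbabilityMeasure_dirichletMeasure hα
    have := Measure.isProbabilityMeasure_map
      (μ := (stickFerguson β σ : Measure (ProbabilityMeasure X))) hm.aemeasurable
    have hset : MeasurableSet {y : Fin (n + 1) → ℝ | ∀ i, y i ∈ Icc (0 : ℝ) 1} := by
      have : {y : Fin (n + 1) → ℝ | ∀ i, y i ∈ Icc (0 : ℝ) 1} =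
          ⋂ i, (fun y => y i) ⁻¹' Icc 0 1 := by
        ext; simp
      rw [this]
      exact MeasurableSet.iInter fun i => measurable_pi_apply i measurableSet_Icc
    refine ext_of_integral_pow ?_ (ae_dirichletMeasure_mem_Icc _) fun s m => ?_
    · rw [ae_map_iff hm.aemeasurable hset]
      exact Eventually.of_forall fun η i => ⟨measureReal_nonneg, measureReal_le_one⟩
    · rw [integral_map hm.aemeasurable (by fun_prop :
        Measurable fun y : Fin (n + 1) → ℝ => (∑ i, s i * y i) ^ m).aestronglyMeasurable]
      exact integral_stickFerguson_of_partition hβ σ hA s m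
  null A hA hA0 := by
    -- The recursion at `m = 0` shows that ηA has mean σA = 0; being nonnegative, it vanishes almost
    -- surely.
    have h := (isNewtonSeq_stickFerguson hβ σ (f := A.indicator 1)
      (measurable_one.indicator hA) (C := 1) (fun x => by
        by_cases hx : x ∈ A <;> simp [hx])).2 0
    have hG : Real.Gamma β ≠ 0 := (Real.Gamma_pos_of_pos hβ).ne'
    have hG1 : Real.Gamma (β + 1) ≠ 0 := (Real.Gamma_pos_of_pos (by positivity)).ne'
    have hreal : (σ : Measure X).real A = 0 := by simp [Measure.real, hA0]
    simp only [integral_indicator_one hA, Finset.HasAntidiagonal.antidiagonal_zero,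
      Finset.sum_singleton, pow_one, zero_add, hreal, Nat.cast_one, Nat.cast_zero,
      Nat.factorial_one, mul_one, mul_zero, zero_mul, one_mul, mul_eq_zero, div_eq_zero_iff, hG,
      hG1, or_self, false_or] at h
    rw [integral_eq_zero_iff_of_nonneg (fun η => measureReal_nonneg)
      (integrable_of_bounded (measurable_real_apply hA) (C := 1) fun η => by
        rw [abs_of_nonneg measureReal_nonneg]; exact measureReal_le_one)] at h
    filter_upwards [h] with η hη
    simpa [Measure.real, ENNReal.toReal_eq_zero_iff, measure_ne_top] using hη

/-! ### Uniqueness of the Dirichlet--Ferguson measure -/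

/-- Fibres of c may be σ-null, so they need not form a nontrivial partition. Null fibres are merged
into a positive one, which almost surely changes no η-mass by the null-set condition. -/
theorem IsDirichletFerguson.map_preimage_singleton_eq {β : ℝ} {σ : ProbabilityMeasure X}
    {D₁ D₂ : ProbabilityMeasure (ProbabilityMeasure X)} (h₁ : IsDirichletFerguson β σ D₁)
    (h₂ : IsDirichletFerguson β σ D₂) {T : Type*} [Finite T] [MeasurableSpace T]
    [MeasurableSingletonClass T] {c : X → T} (hc : Measurable c) :
    (D₁ : Measure (ProbabilityMeasure X)).map
        (fun (η : ProbabilityMeasure X) t => (η : Measure X).real (c ⁻¹' {t})) =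
      (D₂ : Measure (ProbabilityMeasure X)).map
        (fun (η : ProbabilityMeasure X) t => (η : Measure X).real (c ⁻¹' {t})) := by
  classical
  have := Fintype.ofFinite T
  let P := {t : T // 0 < (σ : Measure X) (c ⁻¹' {t})}
  have hne : Nonempty P := by
    by_contra hP
    have h0 : ∀ t, (σ : Measure X) (c ⁻¹' {t}) = 0 := fun t => by
      by_contra ht
      exact hP ⟨⟨t, pos_iff_ne_zero.2 ht⟩⟩
    have hU : (univ : Set X) = ⋃ t, c ⁻¹' {t} := by ext; simp
    have : (σ : Measure X) univ = 0 := by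
      rw [hU]
      exact measure_iUnion_null h0
    simp at this
  obtain ⟨t₀⟩ := hne
  obtain ⟨n, hn⟩ : ∃ n, Fintype.card P = n + 1 :=
    ⟨Fintype.card P - 1, (Nat.succ_pred_eq_of_pos (Fintype.card_pos_iff.2 ⟨t₀⟩)).symm⟩
  let e : P ≃ Fin (n + 1) := Fintype.equivFinOfCardEq hn
  let g : T → P := fun t => if ht : 0 < (σ : Measure X) (c ⁻¹' {t}) then ⟨t, ht⟩ else t₀
  have hg : ∀ p : P, g p = p := fun p => dif_pos p.2
  let A : Fin (n + 1) → Set X := fun i => c ⁻¹' (g ⁻¹' {e.symm i})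
  have hA : IsNontrivialPartition (σ : Measure X) A := by
    refine ⟨fun i => hc (toFinite _).measurableSet, fun i => ?_, fun i j hij => ?_, ?_⟩
    · refine (e.symm i).2.trans_le (measure_mono ?_)
      intro x hx
      have hx' : c x = (e.symm i : T) := hx
      change g (c x) = e.symm i
      rw [hx', hg]
    · refine Set.disjoint_left.2 fun x hx hx' => hij (e.symm.injective ?_)
      exact (show g (c x) = e.symm i from hx).symm.trans hx'
    · refine eq_univ_of_forall fun x => mem_iUnion.2 ⟨e (g (c x)), ?_⟩
      change g (c x) = e.symm (e (g (c x)))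
      simp
  -- `Φ` reinserts the zero coordinates of the null fibres.
  let Φ : (Fin (n + 1) → ℝ) → T → ℝ := fun y t =>
    if ht : 0 < (σ : Measure X) (c ⁻¹' {t}) then y (e ⟨t, ht⟩) else 0
  have hΦ : Measurable Φ := by
    refine measurable_pi_iff.2 fun t => ?_
    by_cases ht : 0 < (σ : Measure X) (c ⁻¹' {t})
    · simpa only [Φ, dif_pos ht] using measurable_pi_apply _
    · simpa only [Φ, dif_neg ht] using measurable_const
  have hmA : Measurable fun (η : ProbabilityMeasure X) (i : Fin (n + 1)) =>
      (η : Measure X).real (A i) :=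
    measurable_pi_iff.2 fun i => measurable_real_apply (hA.measurableSet i)
  have key : ∀ D : ProbabilityMeasure (ProbabilityMeasure X), IsDirichletFerguson β σ D →
      (D : Measure (ProbabilityMeasure X)).map
        (fun (η : ProbabilityMeasure X) t => (η : Measure X).real (c ⁻¹' {t})) =
      (dirichletMeasure fun i => β * (σ : Measure X).real (A i)).map Φ := by
    intro D hD
    rw [← hD.map_eval n A hA, Measure.map_map hΦ hmA]
    refine Measure.map_congr ?_
    have hnull : ∀ᵐ (η : ProbabilityMeasure X) ∂(D : Measure (ProbabilityMeasure X)),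
        ∀ t, (σ : Measure X) (c ⁻¹' {t}) = 0 → (η : Measure X) (c ⁻¹' {t}) = 0 := by
      refine ae_all_iff.2 fun t => ?_
      by_cases ht : (σ : Measure X) (c ⁻¹' {t}) = 0
      · filter_upwards [hD.null _ (hc (measurableSet_singleton t)) ht] with η hη _ using hη
      · exact Eventually.of_forall fun η h => absurd h ht
    filter_upwards [hnull] with η hη
    funext t
    simp only [Function.comp_apply, Φ]
    split_ifs with ht
    -- η-almost every point lies in a positive fibre, where `g` acts as the identity on labels;
    -- hence the enlarged cell and the fibre agree up to an η-null set.
    · have hae : ∀ᵐ x ∂(η : Measure X), 0 < (σ : Measure X) (c ⁻¹' {c x}) := by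
        have : ∀ᵐ x ∂(η : Measure X), ∀ t, (σ : Measure X) (c ⁻¹' {t}) = 0 → c x ≠ t := by
          refine ae_all_iff.2 fun t => ?_
          by_cases ht : (σ : Measure X) (c ⁻¹' {t}) = 0
          · have h0 := measure_eq_zero_iff_ae_notMem.1 (hη t ht)
            filter_upwards [h0] with x hx _ using hx
          · exact Eventually.of_forall fun η h => absurd h ht
        filter_upwards [this] with x hx
        exact pos_iff_ne_zero.2 fun h0 => hx _ h0 rfl
      refine measureReal_congr ?_
      filter_upwards [hae] with x hx
      refine propext ?_
      change c x = t ↔ g (c x) = e.symm (e ⟨t, ht⟩)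
      rw [e.symm_apply_apply]
      simp only [g, dif_pos hx, Subtype.mk.injEq, P]
    · have := hη t (not_not.1 (mt pos_iff_ne_zero.2 ht))
      simp [Measure.real, this]
  rw [key D₁ h₁, key D₂ h₂]

/-- The membership pattern x ↦ (x ∈ Aᵢ)ᵢ takes finitely many values. Its fibres are the atoms of the
algebra generated by the sets, and each ηAᵢ is a sum of atom masses. -/
theorem IsDirichletFerguson.map_finset_eq {β : ℝ} {σ : ProbabilityMeasure X}
    {D₁ D₂ : ProbabilityMeasure (ProbabilityMeasure X)} (h₁ : IsDirichletFerguson β σ D₁)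
    (h₂ : IsDirichletFerguson β σ D₂) {ι : Type*} [Finite ι] {A : ι → Set X}
    (hA : ∀ i, MeasurableSet (A i)) :
    (D₁ : Measure (ProbabilityMeasure X)).map
        (fun (η : ProbabilityMeasure X) i => (η : Measure X).real (A i)) =
      (D₂ : Measure (ProbabilityMeasure X)).map
        (fun (η : ProbabilityMeasure X) i => (η : Measure X).real (A i)) := by
  classical
  have := Fintype.ofFinite ι
  let c : X → ι → Prop := fun x i => x ∈ A i
  have hc : Measurable c := measurable_pi_iff.2 fun i => measurableSet_setOfPred.1 (hA i)
  let Ψ : ((ι → Prop) → ℝ) → ι → ℝ := fun y i => ∑ t : ι → Prop, if t i then y t else 0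
  have hΨ : Measurable Ψ := by
    refine measurable_pi_iff.2 fun i => Finset.measurable_sum _ fun t _ => ?_
    split_ifs
    · exact measurable_pi_apply t
    · exact measurable_const
  have hm : Measurable fun (η : ProbabilityMeasure X) (t : ι → Prop) =>
      (η : Measure X).real (c ⁻¹' {t}) :=
    measurable_pi_iff.2 fun t => measurable_real_apply (hc (measurableSet_singleton t))
  have hcomp : (fun (η : ProbabilityMeasure X) i => (η : Measure X).real (A i)) =
      Ψ ∘ fun (η : ProbabilityMeasure X) t => (η : Measure X).real (c ⁻¹' {t}) := by
    funext η i
    simp only [Function.comp_apply, Ψ]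
    rw [← Finset.sum_filter, ← measureReal_biUnion_finset]
    · congr 1
      ext x
      simp [c]
    · intro t _ u _ htu
      exact Disjoint.preimage _ (Set.disjoint_singleton.2 htu)
    · exact fun t _ => hc (measurableSet_singleton t)
  rw [hcomp, ← Measure.map_map hΨ hm, ← Measure.map_map hΨ hm,
    h₁.map_preimage_singleton_eq h₂ hc]

/-- Finite-dimensional laws fix the law of the whole family of evaluations, as a projective limit,
and evaluations generate the σ-algebra on probability measures. -/
theorem IsDirichletFerguson.unique {β : ℝ} {σ : ProbabilityMeasure X}
    {D₁ D₂ : ProbabilityMeasure (ProbabilityMeasure X)} (h₁ : IsDirichletFerguson β σ D₁)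
    (h₂ : IsDirichletFerguson β σ D₂) : D₁ = D₂ := by
  let ψ : ProbabilityMeasure X → {A : Set X // MeasurableSet A} → ℝ :=
    fun η A => (η : Measure X).real A
  have hψ : Measurable ψ := measurable_pi_iff.2 fun A => measurable_real_apply A.2
  have hproj : (D₁ : Measure (ProbabilityMeasure X)).map ψ =
      (D₂ : Measure (ProbabilityMeasure X)).map ψ := by
    have h : ∀ D : ProbabilityMeasure (ProbabilityMeasure X),
          IsProjectiveLimit ((D : Measure (ProbabilityMeasure X)).map ψ)
          fun J : Finset {A : Set X // MeasurableSet A} =>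
            (D : Measure (ProbabilityMeasure X)).map
              fun (η : ProbabilityMeasure X) (A : J) => (η : Measure X).real A.1 := by
      intro D J
      rw [Measure.map_map (Finset.measurable_restrict J) hψ]
      rfl
    have h2 := h D₂
    have heq : (fun J : Finset {A : Set X // MeasurableSet A} =>
        (D₂ : Measure (ProbabilityMeasure X)).map
          fun (η : ProbabilityMeasure X) (A : J) => (η : Measure X).real A.1) =
        fun J : Finset {A : Set X // MeasurableSet A} =>
          (D₁ : Measure (ProbabilityMeasure X)).map
            fun (η : ProbabilityMeasure X) (A : J) => (η : Measure X).real A.1 := by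
      funext J
      exact h₂.map_finset_eq h₁ fun A : J => A.1.2
    rw [heq] at h2
    have := fun J : Finset {A : Set X // MeasurableSet A} =>
      Measure.isFiniteMeasure_map (D₁ : Measure (ProbabilityMeasure X))
        fun (η : ProbabilityMeasure X) (A : J) => (η : Measure X).real A.1
    exact (h D₁).unique h2
  have hle : (inferInstance : MeasurableSpace (ProbabilityMeasure X)) ≤
      MeasurableSpace.comap ψ inferInstance := by
    have hid : @Measurable _ _ (MeasurableSpace.comap ψ inferInstance) inferInstance
        (fun η : ProbabilityMeasure X => η) := by
      refine @Measurable.subtype_mk _ _ (MeasurableSpace.comap ψ inferInstance) _ _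
        (fun η : ProbabilityMeasure X => (η : Measure X)) ?_ _
      refine @Measure.measurable_of_measurable_coe _ _ _ (MeasurableSpace.comap ψ inferInstance) _
        fun A hA => ?_
      have : (fun η : ProbabilityMeasure X => (η : Measure X) A) =
          (fun y : {A : Set X // MeasurableSet A} → ℝ => ENNReal.ofReal (y ⟨A, hA⟩)) ∘ ψ := by
        funext η
        simp [ψ]
      rw [this]
      exact ((measurable_pi_apply _).ennreal_ofReal).comp (comap_measurable ψ)
    exact fun S hS => hid hS
  refine Subtype.ext (Measure.ext fun S hS => ?_)
  obtain ⟨S', hS', rfl⟩ := hle S hS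
  change (D₁ : Measure (ProbabilityMeasure X)) _ = (D₂ : Measure (ProbabilityMeasure X)) _
  rw [← Measure.map_apply hψ hS', ← Measure.map_apply hψ hS', hproj]

theorem isDirichletFerguson_dirichletFerguson {β : ℝ} (hβ : 0 < β) (σ : ProbabilityMeasure X) :
    IsDirichletFerguson β σ (dirichletFerguson β σ) := by
  have h : ∃ D, IsDirichletFerguson β σ D := ⟨_, isDirichletFerguson_stickFerguson hβ σ⟩
  rw [dirichletFerguson, dif_pos h]
  exact h.choose_spec

theorem dirichletFerguson_eq_stickFerguson {β : ℝ} (hβ : 0 < β) (σ : ProbabilityMeasure X) :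
    dirichletFerguson β σ = stickFerguson β σ :=
  (isDirichletFerguson_dirichletFerguson hβ σ).unique (isDirichletFerguson_stickFerguson hβ σ)

end DirichletFerguson

/-! ### The limits of small and large intensity -/

theorem tendsto_diracProba_of_tendsto_measure_compl {Y : Type*} [TopologicalSpace Y]
    [MeasurableSpace Y] [OpensMeasurableSpace Y] {ι : Type*} {L : Filter ι}
    [L.IsCountablyGenerated] {μ : ι → ProbabilityMeasure Y} {y : Y}
    (h : ∀ U ∈ 𝓝 y, Tendsto (fun i => (μ i : Measure Y) Uᶜ) L (𝓝 0)) :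
    Tendsto μ L (𝓝 (diracProba y)) := by
  rcases L.eq_or_neBot with rfl | _
  · exact tendsto_bot
  refine tendsto_of_forall_isOpen_le_liminf' fun G hG => ?_
  change Measure.dirac y G ≤ _
  by_cases hy : y ∈ G
  · have hc : ∀ i, (μ i : Measure Y) G = 1 - (μ i : Measure Y) Gᶜ := fun i => by
      rw [← prob_compl_eq_one_sub hG.measurableSet.compl, compl_compl]
    have ht : Tendsto (fun i => (μ i : Measure Y) G) L (𝓝 1) := by
      simp_rw [hc]
      simpa using ENNReal.Tendsto.sub tendsto_const_nhds (h G (hG.mem_nhds hy))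
        (Or.inl ENNReal.one_ne_top)
    rw [ht.liminf_eq]
    exact prob_le_one
  · rw [Measure.dirac_apply' _ hG.measurableSet]
    simp [hy]

section Limits

open scoped BoundedContinuousFunction

variable {X : Type*} [MeasurableSpace X]

/-- Newton's recursion at m = 0 and m = 1 gives E[ηf] = σf and (β + 1) E[(ηf)²] = β (σf)² + σ(f²).
-/
theorem variance_stickFerguson {β : ℝ} (hβ : 0 < β) (σ : ProbabilityMeasure X)
    {f : X → ℝ} (hf : Measurable f) {C : ℝ} (hC : ∀ x, |f x| ≤ C) :
    ∫ η : ProbabilityMeasure X, (∫ x, f x ∂(η : Measure X) - ∫ x, f x ∂(σ : Measure X)) ^ 2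
        ∂(stickFerguson β σ : Measure (ProbabilityMeasure X)) =
      (∫ x, f x ^ 2 ∂(σ : Measure X) - (∫ x, f x ∂(σ : Measure X)) ^ 2) / (β + 1) := by
  have hN := isNewtonSeq_stickFerguson hβ σ hf hC
  have hG : Real.Gamma β ≠ 0 := (Real.Gamma_pos_of_pos hβ).ne'
  have h1 := hN.2 0
  have h2 := hN.2 1
  have e1 : Real.Gamma (β + 1) = β * Real.Gamma β := Real.Gamma_add_one hβ.ne'
  have e2 : Real.Gamma (β + 2) = (β + 1) * (β * Real.Gamma β) := by
    rw [← e1, ← Real.Gamma_add_one (by positivity)]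
    ring_nf
  simp only [Finset.Nat.sum_antidiagonal_succ, Finset.HasAntidiagonal.antidiagonal_zero,
    Finset.sum_singleton, Nat.factorial, Nat.cast_zero, Nat.cast_one, zero_add, add_zero, one_mul,
    mul_one, pow_zero, pow_one, one_add_one_eq_two, Nat.cast_ofNat, integral_const, probReal_univ,
    smul_eq_mul, div_self hG, Nat.succ_eq_add_one, e1, e2] at h1 h2
  have hm := measurable_integral_probabilityMeasure hf.stronglyMeasurable
  have hb : ∀ η : ProbabilityMeasure X, |∫ x, f x ∂(η : Measure X)| ≤ C := fun η =>
    abs_integral_le_of_bounded hC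
  have hi1 : Integrable (fun η : ProbabilityMeasure X => ∫ x, f x ∂(η : Measure X))
      (stickFerguson β σ : Measure (ProbabilityMeasure X)) := integrable_of_bounded hm hb
  have hi2 : Integrable (fun η : ProbabilityMeasure X => (∫ x, f x ∂(η : Measure X)) ^ 2)
      (stickFerguson β σ : Measure (ProbabilityMeasure X)) :=
    integrable_of_bounded (hm.pow_const 2) (C := C ^ 2) fun η => by
      rw [abs_pow]
      exact pow_le_pow_left₀ (abs_nonneg _) (hb η) 2
  set M := ∫ x, f x ∂(σ : Measure X)
  have hexp : ∀ η : ProbabilityMeasure X, (∫ x, f x ∂(η : Measure X) - M) ^ 2 =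
      (∫ x, f x ∂(η : Measure X)) ^ 2 - 2 * M * (∫ x, f x ∂(η : Measure X)) + M ^ 2 := by
    intro η; ring
  have hi3 : Integrable (fun η : ProbabilityMeasure X =>
      (∫ x, f x ∂(η : Measure X)) ^ 2 - 2 * M * ∫ x, f x ∂(η : Measure X))
      (stickFerguson β σ : Measure (ProbabilityMeasure X)) := hi2.sub (hi1.const_mul _)
  simp_rw [hexp]
  rw [integral_add hi3 (integrable_const _),
    integral_sub hi2 (hi1.const_mul _), integral_const_mul, integral_const]
  set H1 := ∫ η : ProbabilityMeasure X, ∫ x, f x ∂(η : Measure X)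
    ∂(stickFerguson β σ : Measure (ProbabilityMeasure X))
  set H2 := ∫ η : ProbabilityMeasure X, (∫ x, f x ∂(η : Measure X)) ^ 2
    ∂(stickFerguson β σ : Measure (ProbabilityMeasure X))
  set S := ∫ x, f x ^ 2 ∂(σ : Measure X)
  have hβ1 : β + 1 ≠ 0 := by positivity
  field_simp at h1 h2
  rw [h1] at h2 ⊢
  rw [eq_div_iff hβ1, probReal_univ, one_smul]
  linear_combination h2

/-- For a fixed base u < 1 the first kept fraction u^(1/β) tends to 0, so the first atom absorbs all
the mass and the rest of the stick need not be controlled. -/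
theorem tendsto_stickProba_nhdsGT_zero [TopologicalSpace X] [OpensMeasurableSpace X]
    (σ : ProbabilityMeasure X)
    (ω : ℕ → unitInterval × X) (hω : (ω 0).1 ≠ 1) :
    Tendsto (fun β : ℝ => stickProba β σ ω) (𝓝[>] 0) (𝓝 (diracProba (ω 0).2)) := by
  rw [ProbabilityMeasure.tendsto_iff_forall_integral_tendsto]
  intro g
  have hcons : ω = consSeq (ω 0, fun n => ω (n + 1)) := by
    funext n
    cases n <;> rfl
  have hdirac : ∫ x, g x ∂(diracProba (ω 0).2 : Measure X) = g (ω 0).2 :=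
    integral_dirac' _ _ g.continuous.measurable.stronglyMeasurable
  have hint : ∀ β, ∫ x, g x ∂(stickProba β σ ω : Measure X) =
      (1 - betaFraction β (ω 0).1) * g (ω 0).2 + betaFraction β (ω 0).1 *
        ∫ x, g x ∂(stickProba β σ fun n => ω (n + 1) : Measure X) := by
    intro β
    conv_lhs => rw [hcons]
    exact integral_stickProba_consSeq β σ g.continuous.measurable g.norm_coe_le_norm _
  have hfrac : Tendsto (fun β : ℝ => (betaFraction β (ω 0).1 : ℝ)) (𝓝[>] 0) (𝓝 0) := by
    have hlt : ((ω 0).1 : ℝ) < 1 := lt_of_le_of_ne (ω 0).1.2.2 fun h => hω (Subtype.ext h)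
    exact (tendsto_rpow_atTop_of_base_lt_one _ (by linarith [(ω 0).1.2.1]) hlt).comp
      (tendsto_abs_atTop_atTop.comp tendsto_inv_nhdsGT_zero)
  rw [hdirac]
  simp_rw [hint]
  have h1 : Tendsto (fun β : ℝ => (1 - (betaFraction β (ω 0).1 : ℝ)) * g (ω 0).2) (𝓝[>] 0)
      (𝓝 (g (ω 0).2)) := by
    simpa using ((tendsto_const_nhds (x := (1 : ℝ))).sub hfrac).mul_const (g (ω 0).2)
  have h2 : Tendsto (fun β : ℝ => (betaFraction β (ω 0).1 : ℝ) *
      ∫ x, g x ∂(stickProba β σ fun n => ω (n + 1) : Measure X)) (𝓝[>] 0) (𝓝 0) :=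
    hfrac.zero_mul_isBoundedUnder_le (isBoundedUnder_of ⟨‖g‖, fun β =>
      abs_integral_le_of_bounded g.norm_coe_le_norm⟩)
  simpa using h1.add h2

theorem measurePreserving_stickLaw_snd (σ : Measure X) [IsProbabilityMeasure σ] :
    MeasurePreserving (fun ω : ℕ → unitInterval × X => (ω 0).2) (stickLaw σ) σ :=
  measurePreserving_snd.comp
    (measurePreserving_eval_infinitePi (fun _ : ℕ => (volume : Measure unitInterval).prod σ) 0)

theorem ae_stickLaw_ne_one (σ : Measure X) [IsProbabilityMeasure σ] :
    ∀ᵐ ω ∂stickLaw σ, (ω 0).1 ≠ 1 := by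
  have h : MeasurePreserving (fun ω : ℕ → unitInterval × X => (ω 0).1) (stickLaw σ) volume :=
    measurePreserving_fst.comp
      (measurePreserving_eval_infinitePi (fun _ : ℕ => (volume : Measure unitInterval).prod σ) 0)
  have h1 : ∀ᵐ u : unitInterval, u ≠ 1 := by
    rw [ae_iff]
    simp
  exact h.quasiMeasurePreserving.ae h1

theorem integral_diracPushforward {E : Type*} [NormedAddCommGroup E] [NormedSpace ℝ E]
    (σ : ProbabilityMeasure X) {F : ProbabilityMeasure X → E} (hF : StronglyMeasurable F) :
    ∫ η, F η ∂(diracPushforward σ : Measure (ProbabilityMeasure X)) =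
      ∫ x, F (diracProba x) ∂(σ : Measure X) := by
  change ∫ η, F η ∂((σ : Measure X).map fun x => diracProba x) = _
  rw [integral_map measurable_diracProba_embedding.aemeasurable hF.aestronglyMeasurable]

variable [TopologicalSpace X] [TopologicalSpace.PseudoMetrizableSpace X]
  [SecondCountableTopology X] [BorelSpace X]

theorem tendsto_diracProba_of_tendsto_variance {ι : Type*} {L : Filter ι}
    [L.IsCountablyGenerated] {D : ι → ProbabilityMeasure (ProbabilityMeasure X)}
    {σ : ProbabilityMeasure X}
    (h : ∀ g : X →ᵇ ℝ, Tendsto (fun i => ∫ η : ProbabilityMeasure X,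
      (∫ x, g x ∂(η : Measure X) - ∫ x, g x ∂(σ : Measure X)) ^ 2
        ∂(D i : Measure (ProbabilityMeasure X))) L (𝓝 0)) :
    Tendsto D L (𝓝 (diracProba σ)) := by
  -- The sets whose complements have vanishing mass along `L` form a filter. The goal becomes
  -- convergence of this filter to σ, which can be tested on one bounded continuous function at a
  -- time, where Chebyshev's inequality applies.
  let 𝓕 : Filter (ProbabilityMeasure X) := Filter.comk
    (fun s => Tendsto (fun i => (D i : Measure (ProbabilityMeasure X)) s) L (𝓝 0))
    (by simpa using tendsto_const_nhds)
    (fun t ht s hst => tendsto_of_tendsto_of_tendsto_of_le_of_le tendsto_const_nhds ht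
      (fun _ => zero_le) fun i => measure_mono hst)
    (fun s hs t ht => by
      have := hs.add ht
      rw [add_zero] at this
      exact tendsto_of_tendsto_of_tendsto_of_le_of_le tendsto_const_nhds this
        (fun _ => zero_le) fun i => measure_union_le s t)
  have key : Tendsto (fun η : ProbabilityMeasure X => η) 𝓕 (𝓝 σ) := by
    rw [ProbabilityMeasure.tendsto_iff_forall_integral_tendsto]
    intro g
    rw [Metric.tendsto_nhds]
    intro ε hε
    change Tendsto (fun i => (D i : Measure (ProbabilityMeasure X))
      {η : ProbabilityMeasure X |
        dist (∫ x, g x ∂(η : Measure X)) (∫ x, g x ∂(σ : Measure X)) < ε}ᶜ)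
      L (𝓝 0)
    have hreal : Tendsto (fun i => (ε ^ 2)⁻¹ * ∫ η : ProbabilityMeasure X,
        (∫ x, g x ∂(η : Measure X) - ∫ x, g x ∂(σ : Measure X)) ^ 2
          ∂(D i : Measure (ProbabilityMeasure X))) L (𝓝 0) := by
      simpa using (h g).const_mul (ε ^ 2)⁻¹
    have henn := ENNReal.tendsto_ofReal hreal
    rw [ENNReal.ofReal_zero] at henn
    refine tendsto_of_tendsto_of_tendsto_of_le_of_le tendsto_const_nhds henn
      (fun _ => zero_le) fun i => ?_
    have hm := (measurable_integral_probabilityMeasure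
      g.continuous.measurable.stronglyMeasurable).sub_const (∫ x, g x ∂(σ : Measure X))
    have hint : Integrable (fun η : ProbabilityMeasure X =>
        (∫ x, g x ∂(η : Measure X) - ∫ x, g x ∂(σ : Measure X)) ^ 2)
        (D i : Measure (ProbabilityMeasure X)) :=
      integrable_of_bounded (hm.pow_const 2) (C := (‖g‖ + ‖g‖) ^ 2) fun η => by
        rw [abs_pow]
        refine pow_le_pow_left₀ (abs_nonneg _) ((abs_sub _ _).trans (add_le_add ?_ ?_)) 2 <;>
        exact abs_integral_le_of_bounded g.norm_coe_le_norm
    have hcheb := mul_meas_ge_le_integral_of_nonneg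
      (Eventually.of_forall fun η => sq_nonneg _) hint (ε ^ 2)
    have hset : {η : ProbabilityMeasure X |
        dist (∫ x, g x ∂(η : Measure X)) (∫ x, g x ∂(σ : Measure X)) < ε}ᶜ =
        {η : ProbabilityMeasure X |
          ε ^ 2 ≤ (∫ x, g x ∂(η : Measure X) - ∫ x, g x ∂(σ : Measure X)) ^ 2} := by
      ext η
      simp only [mem_compl_iff, mem_ofPred_eq, not_lt, Real.dist_eq]
      rw [sq_le_sq, abs_of_pos hε]
    change (D i : Measure (ProbabilityMeasure X)) _ ≤ _
    rw [hset, ← ofReal_measureReal]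
    refine ENNReal.ofReal_le_ofReal ?_
    rw [inv_mul_eq_div, le_div_iff₀ (by positivity), mul_comm]
    exact hcheb
  refine tendsto_diracProba_of_tendsto_measure_compl fun U hU => ?_
  exact key hU

theorem tendsto_stickFerguson_atTop (σ : ProbabilityMeasure X) :
    Tendsto (fun β : ℝ => stickFerguson β σ) atTop (𝓝 (diracProba σ)) := by
  refine tendsto_diracProba_of_tendsto_variance fun g => ?_
  have hlim : Tendsto (fun β : ℝ => (∫ x, g x ^ 2 ∂(σ : Measure X) -
      (∫ x, g x ∂(σ : Measure X)) ^ 2) / (β + 1)) atTop (𝓝 0) :=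
    tendsto_const_nhds.div_atTop (tendsto_atTop_add_const_right _ _ tendsto_id)
  refine hlim.congr' ?_
  filter_upwards [eventually_gt_atTop 0] with β hβ
  exact (variance_stickFerguson hβ σ g.continuous.measurable g.norm_coe_le_norm).symm

/-- All β share the probability space `stickLaw`, on which convergence to the Dirac mass at the
first atom is almost sure; that atom has law σ. -/
theorem tendsto_stickFerguson_nhdsGT_zero (σ : ProbabilityMeasure X) :
    Tendsto (fun β : ℝ => stickFerguson β σ) (𝓝[>] 0) (𝓝 (diracPushforward σ)) := by
  rw [ProbabilityMeasure.tendsto_iff_forall_integral_tendsto]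
  intro F
  have hF : StronglyMeasurable F := F.continuous.measurable.stronglyMeasurable
  rw [integral_diracPushforward σ hF]
  simp_rw [integral_stickFerguson _ σ hF]
  have hG : StronglyMeasurable fun x : X => F (diracProba x) :=
    hF.comp_measurable measurable_diracProba_embedding
  have hsnd := measurePreserving_stickLaw_snd (σ : Measure X)
  have hmap := integral_map (μ := stickLaw (σ : Measure X)) hsnd.measurable.aemeasurable
    (f := fun x : X => F (diracProba x)) hG.aestronglyMeasurable
  rw [hsnd.map_eq] at hmap
  rw [hmap]
  refine tendsto_integral_filter_of_dominated_convergence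
    (fun _ => ‖F‖) ?_ ?_ (integrable_const (μ := stickLaw (σ : Measure X)) ‖F‖) ?_
  · exact Eventually.of_forall fun β =>
      (hF.comp_measurable (measurable_stickProba β σ)).aestronglyMeasurable
  · exact Eventually.of_forall fun β => Eventually.of_forall fun ω => F.norm_coe_le_norm _
  · filter_upwards [ae_stickLaw_ne_one (σ : Measure X)] with ω hω
    exact (F.continuous.tendsto _).comp (tendsto_stickProba_nhdsGT_zero σ ω hω)

/-! ### Characteristic functionals -/

/-- The bounded continuous function `η ↦ exp (i t η f)`. -/
noncomputable def expMean (t : ℂ) (f : X →ᵇ ℝ) : ProbabilityMeasure X →ᵇ ℂ :=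
  BoundedContinuousFunction.ofNormedAddCommGroup
    (fun η : ProbabilityMeasure X =>
      Complex.exp (Complex.I * t * ((∫ x, f x ∂(η : Measure X) : ℝ) : ℂ)))
    (Complex.continuous_exp.comp (continuous_const.mul (Complex.continuous_ofReal.comp
      (ProbabilityMeasure.continuous_integral_boundedContinuousFunction f))))
    -- For non-real t the modulus is not 1, but ηf is bounded by the norm of f.
    (Real.exp (‖t‖ * ‖f‖)) fun η => by
      refine (Complex.norm_exp_le_exp_norm _).trans (Real.exp_le_exp.2 ?_)
      rw [norm_mul, norm_mul, Complex.norm_I, one_mul, Complex.norm_real]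
      exact mul_le_mul_of_nonneg_left (abs_integral_le_of_bounded f.norm_coe_le_norm)
        (norm_nonneg _)

theorem tendsto_randomCharFun {ι : Type*} {L : Filter ι}
    {D : ι → ProbabilityMeasure (ProbabilityMeasure X)}
    {D' : ProbabilityMeasure (ProbabilityMeasure X)} (h : Tendsto D L (𝓝 D')) (t : ℂ)
    (f : X →ᵇ ℝ) :
    Tendsto (fun i => randomCharFun (D i) t f) L (𝓝 (randomCharFun D' t f)) :=
  (ProbabilityMeasure.tendsto_iff_forall_integral_rclike_tendsto ℂ).1 h (expMean t f)

theorem randomCharFun_diracPushforward (σ : ProbabilityMeasure X) (t : ℂ) (f : X →ᵇ ℝ) :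
    randomCharFun (diracPushforward σ) t f =
      ∫ x, Complex.exp (Complex.I * t * (f x : ℂ)) ∂(σ : Measure X) := by
  refine (integral_diracPushforward σ
    (expMean t f).continuous.measurable.stronglyMeasurable).trans ?_
  refine integral_congr_ae (Eventually.of_forall fun x => ?_)
  change Complex.exp (Complex.I * t * ((∫ y, f y ∂Measure.dirac x : ℝ) : ℂ)) = _
  rw [integral_dirac' _ _ f.continuous.measurable.stronglyMeasurable]

theorem randomCharFun_diracProba (σ : ProbabilityMeasure X) (t : ℂ) (f : X →ᵇ ℝ) :
    randomCharFun (diracProba σ) t f =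
      Complex.exp (Complex.I * t * ((∫ x, f x ∂(σ : Measure X) : ℝ) : ℂ)) := by
  exact integral_dirac' _ _ (expMean t f).continuous.measurable.stronglyMeasurable

end Limits

/-! ### The main theorem -/

theorem corollaryp {X : Type*} [TopologicalSpace X] [SecondCountableTopology X]
    [LocallyCompactSpace X] [T2Space X] [MeasurableSpace X] [BorelSpace X]
    (σ : ProbabilityMeasure X) :
    (∀ β : ℝ, 0 < β → IsDirichletFerguson β σ (dirichletFerguson β σ)) ∧
    (∀ f : X → ℝ, Continuous f → HasCompactSupport f → ∀ t : ℂ,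
      Tendsto (fun β : ℝ => randomCharFun (dirichletFerguson β σ) t f) (𝓝[>] 0)
        (𝓝 (∫ x, Complex.exp (Complex.I * t * (f x : ℂ)) ∂(σ : Measure X))) ∧
      Tendsto (fun β : ℝ => randomCharFun (dirichletFerguson β σ) t f) atTop
        (𝓝 (Complex.exp (Complex.I * t * ((∫ x, f x ∂(σ : Measure X) : ℝ) : ℂ))))) ∧
    Tendsto (fun β : ℝ => dirichletFerguson β σ) (𝓝[>] 0) (𝓝 (diracPushforward σ)) ∧
    Tendsto (fun β : ℝ => dirichletFerguson β σ) atTop (𝓝 (diracProba σ)) := by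
  have h0 : Tendsto (fun β : ℝ => dirichletFerguson β σ) (𝓝[>] 0) (𝓝 (diracPushforward σ)) := by
    -- Pseudometrizability of X comes from Urysohn's theorem: a locally compact Hausdorff space is
    -- regular, and X is second countable.
    refine (tendsto_stickFerguson_nhdsGT_zero σ).congr' ?_
    filter_upwards [self_mem_nhdsWithin] with β hβ
    exact (dirichletFerguson_eq_stickFerguson hβ σ).symm
  have h1 : Tendsto (fun β : ℝ => dirichletFerguson β σ) atTop (𝓝 (diracProba σ)) := by
    refine (tendsto_stickFerguson_atTop σ).congr' ?_
    filter_upwards [eventually_gt_atTop 0] with β hβ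
    exact (dirichletFerguson_eq_stickFerguson hβ σ).symm
  refine ⟨fun β hβ => isDirichletFerguson_dirichletFerguson hβ σ, fun f hf hfc t => ?_, h0, h1⟩
  -- Compact support enters only through boundedness of f.
  obtain ⟨C, hC⟩ := hfc.exists_bound_of_continuous hf
  let g : BoundedContinuousFunction X ℝ :=
    BoundedContinuousFunction.ofNormedAddCommGroup f hf C hC
  constructor
  · have h := tendsto_randomCharFun h0 t g
    rwa [randomCharFun_diracPushforward] at h
  · have h := tendsto_randomCharFun h1 t g
    rwa [randomCharFun_diracProba] at h
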